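/- Let $T>0$, $\mathbb{T}=\mathbb{R}/\mathbb{Z}$, let $\phi_0:\mathbb{T}\to\mathbb{R}$ be smooth with $\int_{\mathbb{T}}\phi_0=0$, and let $u_0=\phi_0'$. Let $$J=\sup_W \int_{[0,T]\times\mathbb{T}} -\frac{(\partial_t W)^2}{2(1-\partial_x W)}+\partial_t W\,u_0 ,$$ where the supremum is over all smooth $W:[0,T]\times\mathbb{T}\to\mathbb{R}$ such that $W(T,\cdot)=0$, $\partial_x W\le 1$, and $\partial_t W=0$ wherever $\partial_x W=1$ (with $0^2/0=0$, and the value $-\infty$ if the first term is not integrable). Then $J$ is also the optimal value of the measure formulation: $$J=\sup_{(\rho,q)}\int_{[0,T]\times\mathbb{T}} -\frac{q^2}{2\rho}+q\,u_0 ,$$ where the supremum is over all pairs of bounded Borel measures on $[0,T]\times\mathbb{T}$, with $\rho\ge 0$ and $q$ real-valued (signed), which satisfy $\partial_t\rho+\partial_x q=0$, $\rho(T,\cdot)=1$ in the weak sense, i.e. $$\int \partial_t\theta\,d\rho+\int\partial_x\theta\,dq=\int_{\mathbb{T}}\theta(T,x)\,dx$$ for all smooth $\theta$ on $[0,T]\times\mathbb{T}$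 with $\theta(0,\cdot)=0$. Here $\int q^2/(2\rho)\in[0,\infty]$ denotes $\int k\left(\frac{d\rho}{d\lambda},\frac{dq}{d\lambda}\right)d\lambda$ with $\lambda=\rho+|q|$, and $k(r,m)=m^2/(2r)$ if $r>0$, $k(0,0)=0$, $k=+\infty$ otherwise. This last supremum is attained by some $(\rho,q)$ such that $\rho$ is a non-negative measure, $q=v\rho$ with a density $v\in L^2(\rho)$, and $$J=\int_{[0,T]\times\mathbb{T}} -\frac{q^2}{2\rho}+q\,u_0=\int_{[0,T]\times\mathbb{T}} \left(-\frac12 v^2+v\,u_0\right)d\rho .$$ In addition, $$J=\inf_\theta \int_{\mathbb{T}} -\theta(T,x)\,dx ,$$ where the infimum is over all smooth $\theta:[0,T]\times\mathbb{T}\to\mathbb{R}$ such that $\partial_t\theta+\frac12(\partial_x\theta)^2\le 0$ and $\theta(0,\cdot)=\phi_0$. -/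

import Mathlib

open MeasureTheory
open scoped ENNReal ContDiff

noncomputable section

namespace Burgers

/-- The space-time domain `[0,T] × 𝕋`, where `𝕋 = ℝ/ℤ`. -/
abbrev Strip (T : ℝ) : Type := Set.Icc (0 : ℝ) T × UnitAddCircle

/-- The Lebesgue measure `dt dx` on `[0,T] × 𝕋`. -/
def stripVolume (T : ℝ) : Measure (Strip T) :=
  (Measure.comap ((↑) : Set.Icc (0 : ℝ) T → ℝ) volume).prod volume

/-- A smooth function on `𝕋`, i.e. one whose 1-periodic lift to `ℝ` is `C^∞`. -/
def SmoothOnCircle (f : UnitAddCircle → ℝ) : Prop :=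
  ContDiff ℝ ∞ (fun x : ℝ => f (x : UnitAddCircle))

/-- A smooth function of `(t, x) ∈ ℝ × 𝕋`. Smooth functions on `[0,T] × 𝕋` (up to the boundary)
are the restrictions of these functions. -/
def SmoothOnTimeCircle (θ : ℝ → UnitAddCircle → ℝ) : Prop :=
  ContDiff ℝ ∞ (fun p : ℝ × ℝ => θ p.1 (p.2 : UnitAddCircle))

/-- The derivative of a function on `𝕋`. -/
def circleDeriv (f : UnitAddCircle → ℝ) (x : UnitAddCircle) : ℝ :=
  deriv (fun s : ℝ => f (x + (s : UnitAddCircle))) 0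

/-- The partial derivative `∂ₜθ (t, x)`. -/
def dt (θ : ℝ → UnitAddCircle → ℝ) (t : ℝ) (x : UnitAddCircle) : ℝ :=
  deriv (fun s : ℝ => θ s x) t

/-- The partial derivative `∂ₓθ (t, x)`. -/
def dx (θ : ℝ → UnitAddCircle → ℝ) (t : ℝ) (x : UnitAddCircle) : ℝ :=
  circleDeriv (θ t) x

/-- The convex, 1-homogeneous, lower semicontinuous function `m² / (2r)`: it is `0` at
`(r, m) = (0, 0)`, and `+∞` if `r < 0` or if `r = 0 ≠ m`. -/
def kin (r m : ℝ) : ℝ≥0∞ :=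
  if 0 < r then ENNReal.ofReal (m ^ 2 / (2 * r))
  else if r = 0 ∧ m = 0 then 0 else ∞

/-! ### The maximization problem over smooth functions `W` -/

/-- Admissible functions: `W` smooth, `W(T,·) = 0`, `∂ₓW ≤ 1`, and `∂ₜW = 0` wherever
`∂ₓW = 1`. -/
structure AdmissibleW (T : ℝ) (W : ℝ → UnitAddCircle → ℝ) : Prop where
  smooth : SmoothOnTimeCircle W
  final : ∀ x, W T x = 0
  dx_le : ∀ t ∈ Set.Icc 0 T, ∀ x, dx W t x ≤ 1
  dt_eq : ∀ t ∈ Set.Icc 0 T, ∀ x, dx W t x = 1 → dt W t x = 0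

/-- `∫ -(∂ₜW)² / (2(1 - ∂ₓW)) + ∂ₜW u₀` over `[0,T] × 𝕋`, with value `-∞` if the first term is
not integrable. -/
def objectiveW (T : ℝ) (u₀ : UnitAddCircle → ℝ) (W : ℝ → UnitAddCircle → ℝ) : EReal :=
  ((∫ z : Strip T, dt W z.1 z.2 * u₀ z.2 ∂(stripVolume T) : ℝ) : EReal)
    - ((∫⁻ z : Strip T, kin (1 - dx W z.1 z.2) (dt W z.1 z.2) ∂(stripVolume T) :
        ℝ≥0∞) : EReal)

/-- The optimal value `J` of the Burgers maximization problem. -/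
def optimalValue (T : ℝ) (u₀ : UnitAddCircle → ℝ) : EReal :=
  ⨆ (W : ℝ → UnitAddCircle → ℝ) (_ : AdmissibleW T W), objectiveW T u₀ W

/-! ### The measure formulation -/

/-- `ρ` is a bounded non-negative Borel measure, `q` a bounded signed Borel measure, and
`∂ₜρ + ∂ₓq = 0`, `ρ(T,·) = 1` hold in the weak sense: nothing is prescribed at `t = 0`, so the
smooth test functions are those which vanish at `t = 0`. -/
structure AdmissiblePair (T : ℝ) (ρ : Measure (Strip T)) (q : SignedMeasure (Strip T)) :
    Prop where
  finite : IsFiniteMeasure ρ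
  continuity : ∀ θ : ℝ → UnitAddCircle → ℝ, SmoothOnTimeCircle θ → (∀ x, θ 0 x = 0) →
    (∫ z, dt θ z.1 z.2 ∂ρ) + (∫ᵛ z, dx θ z.1 z.2 ∂•q) = ∫ x, θ T x

/-- The functional `∫ q² / (2ρ)` of a pair of measures: the integral of `kin` of the densities of
`ρ` and `q` with respect to the measure `ρ + |q|`, which dominates both. (As `kin` is
1-homogeneous, any other dominating measure gives the same value.) -/
def kineticEnergy {T : ℝ} (ρ : Measure (Strip T)) (q : SignedMeasure (Strip T)) : ℝ≥0∞ :=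
  ∫⁻ z, kin (ρ.rnDeriv (ρ + q.totalVariation) z).toReal (q.rnDeriv (ρ + q.totalVariation) z)
    ∂(ρ + q.totalVariation)

/-- `∫ -q² / (2ρ) + q u₀` over `[0,T] × 𝕋`. -/
def objectivePair {T : ℝ} (u₀ : UnitAddCircle → ℝ) (ρ : Measure (Strip T))
    (q : SignedMeasure (Strip T)) : EReal :=
  ((∫ᵛ z, u₀ z.2 ∂•q : ℝ) : EReal) - ((kineticEnergy ρ q : ℝ≥0∞) : EReal)

/-- The optimal value of the measure formulation. -/
def optimalValueMeasure (T : ℝ) (u₀ : UnitAddCircle → ℝ) : EReal :=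
  ⨆ (ρ : Measure (Strip T)) (q : SignedMeasure (Strip T)) (_ : AdmissiblePair T ρ q),
    objectivePair u₀ ρ q

/-! ### The dual problem -/

/-- Smooth `θ` with `∂ₜθ + ½(∂ₓθ)² ≤ 0` on `[0,T] × 𝕋` and `θ(0,·) = φ₀`. -/
structure Subsolution (T : ℝ) (φ₀ : UnitAddCircle → ℝ) (θ : ℝ → UnitAddCircle → ℝ) : Prop where
  smooth : SmoothOnTimeCircle θ
  initial : ∀ x, θ 0 x = φ₀ x
  hamilton_jacobi : ∀ t ∈ Set.Icc 0 T, ∀ x, dt θ t x + 1 / 2 * (dx θ t x) ^ 2 ≤ 0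

end Burgers

end

/-!
The three problems have the same value because each of them is solved, or approximated, explicitly
through the Hopf–Lax formula. For `R > sup |φ₀'|` and `x` in the circle let `V x` minimize
`φ₀ (x - T w) + T w² / 2` over the velocities `|w| ≤ R`, let `h x` be the minimum, and let
`J = -∫ h`. All the optimal values equal `J`.

* Weak duality (`objective_le_of_subsolution`): testing the continuity equation with `θ - φ₀`, and
  using Young's inequality pointwise, bounds both maximization problems by `∫ -θ(T, ·)` for each
  subsolution `θ`. A potential `W` enters through the densities `1 - ∂ₓW` and `∂ₜW`
  (`continuity_potential`).

* The dual problem reaches `J` (`exists_subsolution`): the soft minimum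
  `-ε log ⨍ exp (-(φ₀ (x - t v) + t v² / 2) / ε) dv` over `|v| ≤ R` is smooth for all real `t` and
  equals `φ₀` at `t = 0`. It violates the Hamilton–Jacobi inequality by at most half the Gibbs
  average of `(v - φ₀')²`, which an integration by parts in `v` bounds by `K ε / (t + ε)`.
  Subtracting a function of time of size `ε log (1 / ε)` gives a subsolution, and a soft minimum
  lies above the minimum.

* The measure problem attains `J` (`exists_admissiblePair`): transport `dt dx` along the straight
  lines ending at `(T, x)` with velocity `V x`. Minimizing trajectories do not cross, which makes
  `V` measurable (`exists_measurable_minimizer`), and the chain rule along trajectories gives the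
  continuity equation and the value of the action (`integral_along_flow`, `integral_action_flow`).
  The velocity density `v` is the conditional expectation of `V` given the position, so by
  convexity its action is no worse.

* The smooth problem approaches `J` (`action_le_optimalValue`): as the trajectories are affine in
  time, smoothing this pair in space alone already gives `1 - ∂ₓW` and `∂ₜW` for an admissible
  smooth `W` (`exists_potential`), and the smoothing does not increase the kinetic energy.
-/

namespace Burgers

/-! ### Signed measures with a density -/

/-- Integrating a bounded function against the signed measure `m μ`. -/
theorem integral_withDensityᵥ {X : Type*} [MeasurableSpace X] {μ : Measure X}
    {m f : X → ℝ} (hm : Integrable m μ) (hf : Measurable f) {C : ℝ} (hC : ∀ x, |f x| ≤ C) :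
    ∫ᵛ x, f x ∂•(μ.withDensityᵥ m) = ∫ x, m x * f x ∂μ := by
  have hpos : Integrable (fun x => (ENNReal.ofReal (m x)).toReal) μ := by
    simpa [ENNReal.toReal_ofReal'] using hm.pos_part
  have hneg : Integrable (fun x => (ENNReal.ofReal (-m x)).toReal) μ := by
    simpa [ENNReal.toReal_ofReal'] using hm.neg_part
  have fin1 : IsFiniteMeasure (μ.withDensity fun x => ENNReal.ofReal (m x)) :=
    isFiniteMeasure_withDensity_ofReal hm.2
  have fin2 : IsFiniteMeasure (μ.withDensity fun x => ENNReal.ofReal (-m x)) :=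
    isFiniteMeasure_withDensity_ofReal hm.neg.2
  have key (n : X → ℝ) (hn : Integrable n μ)
      [IsFiniteMeasure (μ.withDensity fun x => ENNReal.ofReal (n x))] :
      ∫ᵛ x, f x ∂•((μ.withDensity fun x => ENNReal.ofReal (n x)).toSignedMeasure)
        = ∫ x, max (n x) 0 * f x ∂μ := by
    have : ∫ᵛ x, f x ∂•((μ.withDensity fun x => ENNReal.ofReal (n x)).toSignedMeasure)
        = ∫ x, f x ∂(μ.withDensity fun x => ENNReal.ofReal (n x)) := by
      have := VectorMeasure.integral_toSignedMeasure
        (μ := μ.withDensity fun x => ENNReal.ofReal (n x)) (f := f)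
      have hfl : (ContinuousLinearMap.lsmul ℝ ℝ : ℝ →L[ℝ] ℝ →L[ℝ] ℝ).flip
          = ContinuousLinearMap.lsmul ℝ ℝ := by
        ext; simp
      rw [← this, hfl]
    rw [this, integral_withDensity_eq_integral_toReal_smul₀ hn.1.aemeasurable.ennreal_ofReal
      (by simp)]
    simp [ENNReal.toReal_ofReal']
  have bdd (n : X → ℝ) (hn : Integrable n μ) : Integrable (fun x => n x * f x) μ :=
    hn.mul_bdd (c := C) hf.aestronglyMeasurable (by simpa using Filter.Eventually.of_forall hC)
  have int (ν : Measure X) [IsFiniteMeasure ν] : ν.toSignedMeasure.Integrable f := by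
    simp only [VectorMeasure.Integrable, Measure.variation_toSignedMeasure]
    exact Integrable.of_bound hf.aestronglyMeasurable C (Filter.Eventually.of_forall hC)
  rw [withDensityᵥ_eq_withDensity_pos_part_sub_withDensity_neg_part hm,
    VectorMeasure.integral_sub_vectorMeasure (int _) (int _), key m hm, key (fun x => -m x) hm.neg,
    ← integral_sub (bdd _ hm.pos_part) (bdd _ hm.neg_part)]
  congr 1; ext x
  rw [← sub_mul]
  congr 1
  exact max_zero_sub_max_neg_zero_eq_self _

/-! ### Differentiation under the integral sign -/

/-- A continuous function of a point and a parameter is bounded near each point, uniformly over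
almost all parameters, if these are confined to a bounded set. This provides the dominating
constants for the parametric integrals below. -/
theorem exists_bound_comp {E H F X : Type*} [NormedAddCommGroup E] [NormedSpace ℝ E]
    [FiniteDimensional ℝ E] [NormedAddCommGroup H] [NormedSpace ℝ H] [FiniteDimensional ℝ H]
    [NormedAddCommGroup F] [MeasurableSpace X] {μ : Measure X} {a : X → H} {R : ℝ}
    {f : E × H → F} (hf : Continuous f) (hR : ∀ᵐ x ∂μ, ‖a x‖ ≤ R) (p₀ : E) :
    ∃ C, ∀ᵐ x ∂μ, ∀ p ∈ Metric.ball p₀ 1, ‖f (p, a x)‖ ≤ C := by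
  have := FiniteDimensional.proper ℝ E
  have := FiniteDimensional.proper ℝ H
  obtain ⟨C, hC⟩ := ((isCompact_closedBall p₀ 1).prod
    (isCompact_closedBall (0 : H) R)).exists_bound_of_continuousOn hf.continuousOn
  exact ⟨C, hR.mono fun x hx p hp => hC (p, a x)
    ⟨Metric.ball_subset_closedBall hp, by simpa using hx⟩⟩

theorem aestronglyMeasurable_comp {E H F X : Type*} [NormedAddCommGroup E]
    [NormedAddCommGroup H] [NormedSpace ℝ H] [FiniteDimensional ℝ H]
    [MeasurableSpace H] [BorelSpace H] [NormedAddCommGroup F] [MeasurableSpace X]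
    {μ : Measure X} {a : X → H} {f : E × H → F} (hf : Continuous f) (ha : Measurable a) (p : E) :
    AEStronglyMeasurable (fun x => f (p, a x)) μ := by
  have h : Continuous fun y => f (p, y) := by fun_prop
  exact (h.stronglyMeasurable.comp_measurable ha).aestronglyMeasurable

theorem integrable_comp {E H F X : Type*} [NormedAddCommGroup E] [NormedSpace ℝ E]
    [FiniteDimensional ℝ E] [NormedAddCommGroup H] [NormedSpace ℝ H] [FiniteDimensional ℝ H]
    [MeasurableSpace H] [BorelSpace H] [NormedAddCommGroup F] [MeasurableSpace X]
    {μ : Measure X} [IsFiniteMeasure μ] {a : X → H} {R : ℝ}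
    {f : E × H → F} (hf : Continuous f) (ha : Measurable a)
    (hR : ∀ᵐ x ∂μ, ‖a x‖ ≤ R) (p : E) : Integrable (fun x => f (p, a x)) μ := by
  obtain ⟨C, hC⟩ := exists_bound_comp hf hR p
  exact Integrable.of_bound (aestronglyMeasurable_comp hf ha p) C
    (hC.mono fun x hx => hx p (by simp))

theorem hasFDerivAt_integral_comp {E H F X : Type*} [NormedAddCommGroup E] [NormedSpace ℝ E]
    [FiniteDimensional ℝ E] [NormedAddCommGroup H] [NormedSpace ℝ H] [FiniteDimensional ℝ H]
    [MeasurableSpace H] [BorelSpace H] [NormedAddCommGroup F] [NormedSpace ℝ F] [MeasurableSpace X]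
    {μ : Measure X} [IsFiniteMeasure μ] {a : X → H} {R : ℝ}
    {f : E × H → F} (hf : ContDiff ℝ 1 f) (ha : Measurable a)
    (hR : ∀ᵐ x ∂μ, ‖a x‖ ≤ R) (p : E) :
    HasFDerivAt (fun p => ∫ x, f (p, a x) ∂μ)
      (∫ x, (fderiv ℝ f (p, a x)).comp (ContinuousLinearMap.inl ℝ E H) ∂μ) p := by
  have hg : Continuous fun z => (fderiv ℝ f z).comp (ContinuousLinearMap.inl ℝ E H) :=
    (hf.continuous_fderiv one_ne_zero).clm_comp continuous_const
  obtain ⟨C, hC⟩ := exists_bound_comp hg hR p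
  refine hasFDerivAt_integral_of_dominated_of_fderiv_le (bound := fun _ => C)
    (Metric.ball_mem_nhds p one_pos)
    (Filter.Eventually.of_forall fun q => aestronglyMeasurable_comp hf.continuous ha q)
    (integrable_comp hf.continuous ha hR p)
    (aestronglyMeasurable_comp hg ha p)
    hC (integrable_const C)
    (Filter.Eventually.of_forall fun x q _ => ?_)
  have h1 : HasFDerivAt f (fderiv ℝ f (q, a x)) (q, a x) :=
    (hf.differentiable one_ne_zero _).hasFDerivAt
  exact h1.comp q (hasFDerivAt_prodMk_left q (a x))

/-- Differentiation under the integral sign along a curve. The pointwise derivative `D` may be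
computed by hand; it is automatically the integrable one. -/
theorem hasDerivAt_integral_comp {E H X : Type*} [NormedAddCommGroup E] [NormedSpace ℝ E]
    [FiniteDimensional ℝ E] [NormedAddCommGroup H] [NormedSpace ℝ H] [FiniteDimensional ℝ H]
    [MeasurableSpace H] [BorelSpace H] [MeasurableSpace X] {μ : Measure X} [IsFiniteMeasure μ]
    {a : X → H} {R : ℝ} {f : E × H → ℝ} (hf : ContDiff ℝ 1 f) (ha : Measurable a)
    (hR : ∀ᵐ x ∂μ, ‖a x‖ ≤ R) {c : ℝ → E} {c' : E} {t : ℝ} (hc : HasDerivAt c c' t) {D : H → ℝ}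
    (hD : ∀ h, HasDerivAt (fun s => f (c s, h)) (D h) t) :
    HasDerivAt (fun s => ∫ x, f (c s, a x) ∂μ) (∫ x, D (a x) ∂μ) t := by
  have h1 := (hasFDerivAt_integral_comp (μ := μ) hf ha hR (c t)).comp_hasDerivAt t hc
  have hg : Continuous fun z => (fderiv ℝ f z).comp (ContinuousLinearMap.inl ℝ E H) :=
    (hf.continuous_fderiv one_ne_zero).clm_comp continuous_const
  refine h1.congr_deriv ?_
  rw [ContinuousLinearMap.integral_apply (integrable_comp hg ha hR (c t))]
  congr 1; ext x
  have h2 : HasFDerivAt f (fderiv ℝ f (c t, a x)) (c t, a x) :=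
    (hf.differentiable one_ne_zero _).hasFDerivAt
  exact (h2.comp_hasDerivAt t (hc.prodMk (hasDerivAt_const t (a x)))).unique (hD (a x))

/-- Differentiation under the integral sign, iterated. -/
theorem contDiff_integral_comp {E H X : Type*} [NormedAddCommGroup E] [NormedSpace ℝ E]
    [FiniteDimensional ℝ E] [NormedAddCommGroup H] [NormedSpace ℝ H] [FiniteDimensional ℝ H]
    [MeasurableSpace H] [BorelSpace H] [MeasurableSpace X] {μ : Measure X} [IsFiniteMeasure μ]
    {a : X → H} {R : ℝ} (ha : Measurable a) (hR : ∀ᵐ x ∂μ, ‖a x‖ ≤ R)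
    {f : E × H → ℝ} (hf : ContDiff ℝ ∞ f) :
    ContDiff ℝ ∞ (fun p => ∫ x, f (p, a x) ∂μ) := by
  rw [contDiff_infty]
  intro n
  induction n generalizing f with
  | zero =>
    rw [Nat.cast_zero, contDiff_zero, continuous_iff_continuousAt]
    exact fun p => (hasFDerivAt_integral_comp (hf.of_le (by simp)) ha hR p).continuousAt
  | succ n ih =>
    have hd (p : E) := hasFDerivAt_integral_comp (μ := μ) (hf.of_le (by simp)) ha hR p
    rw [Nat.cast_add, Nat.cast_one, contDiff_succ_iff_fderiv_apply]
    refine ⟨fun p => (hd p).differentiableAt, by simp, fun y => ?_⟩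
    have : (fun p => (fderiv ℝ (fun p => ∫ x, f (p, a x) ∂μ) p) y)
        = fun p => ∫ x, (fun z => fderiv ℝ f z (y, 0)) (p, a x) ∂μ := by
      ext p
      rw [(hd p).fderiv, ContinuousLinearMap.integral_apply]
      · simp
      · have hc : Continuous fun z => (fderiv ℝ f z).comp (ContinuousLinearMap.inl ℝ E H) :=
          (hf.continuous_fderiv (by simp)).clm_comp continuous_const
        exact integrable_comp hc ha hR p
    rw [this]
    refine ih (f := fun z => fderiv ℝ f z (y, 0)) ?_
    exact (hf.fderiv_right (m := ∞) (by simp)).clm_apply contDiff_const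

/-! ### Calculus on the circle and on the strip -/

theorem circleDeriv_coe (f : UnitAddCircle → ℝ) (y : ℝ) :
    circleDeriv f (y : UnitAddCircle) = deriv (fun s : ℝ => f (s : UnitAddCircle)) y := by
  have h : (fun s : ℝ => f ((y : UnitAddCircle) + (s : UnitAddCircle)))
      = fun s => (fun s : ℝ => f (s : UnitAddCircle)) (y + s) := by
    ext s; simp
  rw [circleDeriv, h, deriv_comp_const_add (f := fun s : ℝ => f (s : UnitAddCircle)), add_zero]

/-- Continuity on `ℝ × 𝕋` can be tested on the periodic lift. -/
theorem isOpenQuotientMap_prodMk_coe :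
    IsOpenQuotientMap (Prod.map id ((↑) : ℝ → UnitAddCircle) : ℝ × ℝ → ℝ × UnitAddCircle) :=
  IsOpenQuotientMap.id.prodMap QuotientAddGroup.isOpenQuotientMap_mk

namespace SmoothOnTimeCircle

variable {θ η : ℝ → UnitAddCircle → ℝ}

theorem continuous (hθ : SmoothOnTimeCircle θ) :
    Continuous fun p : ℝ × UnitAddCircle => θ p.1 p.2 :=
  isOpenQuotientMap_prodMk_coe.continuous_comp_iff.1 (ContDiff.continuous hθ)

theorem hasFDerivAt (hθ : SmoothOnTimeCircle θ) (p : ℝ × ℝ) :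
    HasFDerivAt (fun p : ℝ × ℝ => θ p.1 (p.2 : UnitAddCircle))
      (fderiv ℝ (fun p : ℝ × ℝ => θ p.1 (p.2 : UnitAddCircle)) p) p :=
  (ContDiff.differentiable hθ (by simp) p).hasFDerivAt

theorem hasDerivAt_fst (hθ : SmoothOnTimeCircle θ) (t y : ℝ) :
    HasDerivAt (fun s : ℝ => θ s (y : UnitAddCircle))
      (fderiv ℝ (fun p : ℝ × ℝ => θ p.1 (p.2 : UnitAddCircle)) (t, y) (1, 0)) t :=
  HasFDerivAt.comp_hasDerivAt (f := fun s : ℝ => (s, y)) t (hθ.hasFDerivAt (t, y))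
    ((hasDerivAt_id t).prodMk (hasDerivAt_const t y))

theorem hasDerivAt_snd (hθ : SmoothOnTimeCircle θ) (t y : ℝ) :
    HasDerivAt (fun s : ℝ => θ t (s : UnitAddCircle))
      (fderiv ℝ (fun p : ℝ × ℝ => θ p.1 (p.2 : UnitAddCircle)) (t, y) (0, 1)) y :=
  HasFDerivAt.comp_hasDerivAt (f := fun s : ℝ => (t, s)) y (hθ.hasFDerivAt (t, y))
    ((hasDerivAt_const y t).prodMk (hasDerivAt_id y))

theorem dt_coe (hθ : SmoothOnTimeCircle θ) (t y : ℝ) :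
    dt θ t (y : UnitAddCircle)
      = fderiv ℝ (fun p : ℝ × ℝ => θ p.1 (p.2 : UnitAddCircle)) (t, y) (1, 0) :=
  (hθ.hasDerivAt_fst t y).deriv

theorem dx_coe (hθ : SmoothOnTimeCircle θ) (t y : ℝ) :
    dx θ t (y : UnitAddCircle)
      = fderiv ℝ (fun p : ℝ × ℝ => θ p.1 (p.2 : UnitAddCircle)) (t, y) (0, 1) := by
  rw [dx, circleDeriv_coe]
  exact (hθ.hasDerivAt_snd t y).deriv

theorem hasDerivAt_dt (hθ : SmoothOnTimeCircle θ) (t : ℝ) (x : UnitAddCircle) :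
    HasDerivAt (fun s : ℝ => θ s x) (dt θ t x) t := by
  induction x using QuotientAddGroup.induction_on with | H y =>
  exact (hθ.dt_coe t y) ▸ hθ.hasDerivAt_fst t y

theorem hasDerivAt_dx (hθ : SmoothOnTimeCircle θ) (t y : ℝ) :
    HasDerivAt (fun s : ℝ => θ t (s : UnitAddCircle)) (dx θ t (y : UnitAddCircle)) y :=
  (hθ.dx_coe t y) ▸ hθ.hasDerivAt_snd t y

theorem dt (hθ : SmoothOnTimeCircle θ) : SmoothOnTimeCircle (dt θ) := by
  unfold SmoothOnTimeCircle
  simp_rw [hθ.dt_coe]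
  exact (ContDiff.fderiv_right (m := ∞) hθ (by simp)).clm_apply contDiff_const

theorem dx (hθ : SmoothOnTimeCircle θ) : SmoothOnTimeCircle (dx θ) := by
  unfold SmoothOnTimeCircle
  simp_rw [hθ.dx_coe]
  exact (ContDiff.fderiv_right (m := ∞) hθ (by simp)).clm_apply contDiff_const

theorem dt_dx_comm (hθ : SmoothOnTimeCircle θ) (t : ℝ) (x : UnitAddCircle) :
    Burgers.dt (Burgers.dx θ) t x = Burgers.dx (Burgers.dt θ) t x := by
  induction x using QuotientAddGroup.induction_on with | H y =>
  set L : ℝ × ℝ → ℝ := fun p => θ p.1 (p.2 : UnitAddCircle)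
  have hd : DifferentiableAt ℝ (fderiv ℝ L) (t, y) :=
    (ContDiff.fderiv_right (m := ∞) hθ (by simp)).differentiable (by simp) _
  have h (e : ℝ × ℝ) : HasFDerivAt (fun p => fderiv ℝ L p e)
      ((fderiv ℝ (fderiv ℝ L) (t, y)).flip e) (t, y) := by
    simpa using hd.hasFDerivAt.clm_apply (hasFDerivAt_const e (t, y))
  have h1 := hθ.dx.dt_coe t y
  have h2 := hθ.dt.dx_coe t y
  simp_rw [hθ.dx_coe] at h1
  simp_rw [hθ.dt_coe] at h2
  have hs : IsSymmSndFDerivAt ℝ L (t, y) :=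
    (ContDiff.contDiffAt hθ).isSymmSndFDerivAt (by simpa using ENat.LEInfty.out)
  refine h1.trans (Eq.trans ?_ h2.symm)
  change fderiv ℝ (fun p => fderiv ℝ L p (0, 1)) (t, y) (1, 0)
    = fderiv ℝ (fun p => fderiv ℝ L p (1, 0)) (t, y) (0, 1)
  rw [(h _).fderiv, (h _).fderiv]
  exact hs (1, 0) (0, 1)

theorem mul (hθ : SmoothOnTimeCircle θ) (hη : SmoothOnTimeCircle η) :
    SmoothOnTimeCircle fun t x => θ t x * η t x :=
  ContDiff.mul hθ hη

theorem sub (hθ : SmoothOnTimeCircle θ) (hη : SmoothOnTimeCircle η) :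
    SmoothOnTimeCircle fun t x => θ t x - η t x :=
  ContDiff.sub hθ hη

/-- The spatial derivative of a smooth function has mean zero on each time slice. -/
theorem integral_dx (hθ : SmoothOnTimeCircle θ) (t : ℝ) : ∫ x, Burgers.dx θ t x = 0 := by
  rw [← UnitAddCircle.intervalIntegral_preimage 0 (Burgers.dx θ t),
    intervalIntegral.integral_eq_sub_of_hasDerivAt (fun y _ => hθ.hasDerivAt_dx t y)]
  · have : ((0 + 1 : ℝ) : UnitAddCircle) = ((0 : ℝ) : UnitAddCircle) := by
      simp
    rw [this, sub_self]
  · refine Continuous.intervalIntegrable ?_ _ _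
    exact (ContDiff.continuous hθ.dx).comp (continuous_const.prodMk continuous_id)

theorem integral_dt (hθ : SmoothOnTimeCircle θ) (T : ℝ) (x : UnitAddCircle) :
    ∫ t in (0 : ℝ)..T, Burgers.dt θ t x = θ T x - θ 0 x :=
  intervalIntegral.integral_eq_sub_of_hasDerivAt (fun t _ => hθ.hasDerivAt_dt t x)
    ((hθ.dt.continuous.comp (continuous_id.prodMk continuous_const)).intervalIntegrable _ _)

theorem dt_mul (hθ : SmoothOnTimeCircle θ) (hη : SmoothOnTimeCircle η) (t : ℝ)
    (x : UnitAddCircle) : Burgers.dt (fun t x => θ t x * η t x) t x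
      = Burgers.dt θ t x * η t x + θ t x * Burgers.dt η t x :=
  ((hθ.hasDerivAt_dt t x).mul (hη.hasDerivAt_dt t x)).deriv

theorem dx_mul (hθ : SmoothOnTimeCircle θ) (hη : SmoothOnTimeCircle η) (t : ℝ)
    (x : UnitAddCircle) : Burgers.dx (fun t x => θ t x * η t x) t x
      = Burgers.dx θ t x * η t x + θ t x * Burgers.dx η t x := by
  induction x using QuotientAddGroup.induction_on with | H y =>
  exact ((hθ.mul hη).hasDerivAt_dx t y).unique
    ((hθ.hasDerivAt_dx t y).mul (hη.hasDerivAt_dx t y))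

end SmoothOnTimeCircle

theorem SmoothOnCircle.continuous {f : UnitAddCircle → ℝ} (hf : SmoothOnCircle f) :
    Continuous f :=
  (QuotientAddGroup.isOpenQuotientMap_mk (G := ℝ)).continuous_comp_iff.1 (ContDiff.continuous hf)

theorem SmoothOnCircle.hasDerivAt {f : UnitAddCircle → ℝ} (hf : SmoothOnCircle f) (y : ℝ) :
    HasDerivAt (fun s : ℝ => f (s : UnitAddCircle)) (circleDeriv f (y : UnitAddCircle)) y := by
  rw [circleDeriv_coe]
  exact (ContDiff.differentiable hf (by simp) y).hasDerivAt

theorem SmoothOnCircle.circleDeriv {f : UnitAddCircle → ℝ} (hf : SmoothOnCircle f) :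
    SmoothOnCircle (circleDeriv f) := by
  unfold SmoothOnCircle
  simp_rw [circleDeriv_coe]
  exact ContDiff.deriv' (n := ∞) hf

theorem SmoothOnCircle.smoothOnTimeCircle {f : UnitAddCircle → ℝ} (hf : SmoothOnCircle f) :
    SmoothOnTimeCircle fun _ x => f x :=
  ContDiff.comp (g := fun s : ℝ => f (s : UnitAddCircle)) hf contDiff_snd

theorem exists_abs_le_of_continuous {f : UnitAddCircle → ℝ} (hf : Continuous f) :
    ∃ C, 0 ≤ C ∧ ∀ x, |f x| ≤ C := by
  obtain ⟨C, hC⟩ := isCompact_univ.exists_bound_of_continuousOn hf.continuousOn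
  exact ⟨C, (norm_nonneg _).trans (hC 0 trivial), fun x => hC x trivial⟩

/-! ### Integration on the strip -/

instance (T : ℝ) : IsFiniteMeasure
    (Measure.comap ((↑) : Set.Icc (0 : ℝ) T → ℝ) (volume : Measure ℝ)) where
  measure_univ_lt_top := by
    rw [(MeasurableEmbedding.subtype_coe measurableSet_Icc).comap_apply, Set.image_univ,
      Subtype.range_coe]
    exact measure_Icc_lt_top

instance (T : ℝ) : IsFiniteMeasure (stripVolume T) := by
  unfold stripVolume; infer_instance

theorem integral_comap_Icc {T : ℝ} (hT : 0 ≤ T) (g : ℝ → ℝ) :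
    ∫ t : Set.Icc (0 : ℝ) T, g t ∂(Measure.comap ((↑) : Set.Icc (0 : ℝ) T → ℝ) volume)
      = ∫ t in (0 : ℝ)..T, g t := by
  rw [integral_subtype_comap measurableSet_Icc, integral_Icc_eq_integral_Ioc,
    intervalIntegral.integral_of_le hT]

/-- Fubini on the strip, integrating first in time. -/
theorem integral_strip {T : ℝ} (hT : 0 ≤ T) {f : ℝ → UnitAddCircle → ℝ}
    (hf : Integrable (fun z : Strip T => f z.1 z.2) (stripVolume T)) :
    ∫ z : Strip T, f z.1 z.2 ∂(stripVolume T) = ∫ x, ∫ t in (0 : ℝ)..T, f t x := by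
  rw [stripVolume, integral_prod_symm _ hf]
  congr 1; ext x
  exact integral_comap_Icc hT fun t => f t x

/-- Fubini on the strip, integrating first in space. -/
theorem integral_strip' {T : ℝ} (hT : 0 ≤ T) {f : ℝ → UnitAddCircle → ℝ}
    (hf : Integrable (fun z : Strip T => f z.1 z.2) (stripVolume T)) :
    ∫ z : Strip T, f z.1 z.2 ∂(stripVolume T) = ∫ t in (0 : ℝ)..T, ∫ x, f t x := by
  rw [stripVolume, integral_prod _ hf]
  exact integral_comap_Icc hT fun t => ∫ x, f t x

theorem continuous_strip {T : ℝ} {f : ℝ → UnitAddCircle → ℝ}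
    (hf : Continuous fun p : ℝ × UnitAddCircle => f p.1 p.2) :
    Continuous fun z : Strip T => f z.1 z.2 :=
  hf.comp ((continuous_subtype_val.comp continuous_fst).prodMk continuous_snd)

theorem exists_abs_le_of_continuous_strip {T : ℝ} {f : Strip T → ℝ} (hf : Continuous f) :
    ∃ C, ∀ z, |f z| ≤ C := by
  obtain ⟨C, hC⟩ := isCompact_univ.exists_bound_of_continuousOn hf.continuousOn
  exact ⟨C, fun x => hC x trivial⟩

theorem integrable_strip {T : ℝ} {f : Strip T → ℝ} (hf : Continuous f)
    {μ : Measure (Strip T)} [IsFiniteMeasure μ] : Integrable f μ := by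
  obtain ⟨C, hC⟩ := exists_abs_le_of_continuous_strip hf
  exact Integrable.of_bound hf.aestronglyMeasurable C (Filter.Eventually.of_forall hC)

/-- The pair `(1 - ∂ₓW, ∂ₜW)` solves the continuity equation: integrating `∂ₜ(∂ₓψ W)` and
`∂ₓ(∂ₜψ W)` over the strip and subtracting, only boundary terms remain. -/
theorem continuity_potential {T : ℝ} (hT : 0 ≤ T) {W ψ : ℝ → UnitAddCircle → ℝ}
    (hW : SmoothOnTimeCircle W) (hWT : ∀ x, W T x = 0) (hψ : SmoothOnTimeCircle ψ)
    (hψ0 : ∀ x, ψ 0 x = 0) :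
    ∫ z : Strip T, (dt ψ z.1 z.2 * (1 - dx W z.1 z.2) + dx ψ z.1 z.2 * dt W z.1 z.2)
      ∂(stripVolume T) = ∫ x, ψ T x := by
  have hA := (hψ.dx.mul hW)
  have hB := (hψ.dt.mul hW)
  have hdx0 (x : UnitAddCircle) : dx ψ 0 x = 0 := by
    have : ψ 0 = fun _ => 0 := funext hψ0
    simp [dx, circleDeriv, this]
  have key (z : Strip T) : dt ψ z.1 z.2 * (1 - dx W z.1 z.2) + dx ψ z.1 z.2 * dt W z.1 z.2
      = dt ψ z.1 z.2 + dt (fun t x => dx ψ t x * W t x) z.1 z.2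
        - dx (fun t x => dt ψ t x * W t x) z.1 z.2 := by
    rw [hψ.dx.dt_mul hW, hψ.dt.dx_mul hW, hψ.dt_dx_comm]
    ring
  have i1 := integrable_strip (T := T) (continuous_strip hψ.dt.continuous) (μ := stripVolume T)
  have i2 := integrable_strip (T := T) (continuous_strip hA.dt.continuous) (μ := stripVolume T)
  have i3 := integrable_strip (T := T) (continuous_strip hB.dx.continuous) (μ := stripVolume T)
  simp_rw [key]
  rw [integral_sub (by simpa using! i1.add i2) i3, integral_add i1 i2, integral_strip hT i1,
    integral_strip hT i2, integral_strip' hT i3]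
  simp_rw [hψ.integral_dt, hA.integral_dt, hB.integral_dx, hψ0, hWT, hdx0]
  simp

/-! ### The kinetic energy density -/

theorem measurable_kin : Measurable fun p : ℝ × ℝ => kin p.1 p.2 := by
  unfold kin
  refine Measurable.ite (measurableSet_lt measurable_const measurable_fst) (by fun_prop) ?_
  refine Measurable.ite ?_ measurable_const measurable_const
  exact (measurableSet_eq_fun measurable_fst measurable_const).inter
    (measurableSet_eq_fun measurable_snd measurable_const)

/-- Young's inequality: `kin` is the supremum over `s` of the linear functions
`(r, m) ↦ s m - s² r / 2`. -/
theorem mul_sub_le_kin {r m : ℝ} (h : kin r m ≠ ⊤) (s : ℝ) :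
    s * m - 1 / 2 * s ^ 2 * r ≤ (kin r m).toReal := by
  unfold kin at h ⊢
  split_ifs at h ⊢ with h1 h2
  · rw [ENNReal.toReal_ofReal (by positivity), le_div_iff₀ (by positivity)]
    nlinarith [sq_nonneg (m - s * r)]
  · simp [h2.1, h2.2]
  · exact absurd rfl h

/-- If `E` dominates all the linear functions `(D, N) ↦ 2 s N - s² D`, then `kin D N ≤ E / 2`.
This is how Jensen's inequality for `kin` enters: the hypotheses are stable under averaging. -/
theorem kin_le_of_forall {D N E : ℝ} (hD : 0 ≤ D) (h : ∀ s, 0 ≤ E - 2 * s * N + s ^ 2 * D) :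
    kin D N ≤ ENNReal.ofReal (E / 2) ∧ (D = 0 → N = 0) := by
  have h0 : D = 0 → N = 0 := by
    intro hD0
    by_contra hN
    have := h ((E + 1) / (2 * N))
    rw [hD0, show 2 * ((E + 1) / (2 * N)) * N = E + 1 by field_simp] at this
    linarith
  refine ⟨?_, h0⟩
  unfold kin
  split_ifs with h1 h2
  · refine ENNReal.ofReal_le_ofReal ?_
    have := h (N / D)
    rw [div_le_div_iff₀ (by positivity) (by norm_num)]
    have h3 : (E - 2 * (N / D) * N + (N / D) ^ 2 * D) * D = E * D - N ^ 2 := by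
      field_simp; ring
    nlinarith [mul_nonneg this hD]
  · exact zero_le
  · have := le_antisymm (not_lt.1 h1) hD
    exact absurd ⟨this, h0 this⟩ h2

theorem kin_self_mul {r v : ℝ} (hr : 0 ≤ r) :
    kin r (r * v) = ENNReal.ofReal r * ENNReal.ofReal (1 / 2 * v ^ 2) := by
  unfold kin
  split_ifs with h1 h2
  · rw [← ENNReal.ofReal_mul hr]
    congr 1
    field_simp
  · simp [h2.1]
  · have := le_antisymm (not_lt.1 h1) hr
    exact absurd ⟨this, by simp [this]⟩ h2

/-! ### Weak duality -/

/-- Weak duality, for densities `r ≥ 0` and `m` with respect to an arbitrary measure: test the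
continuity equation with `θ - φ₀`, and use Young's inequality with slope `∂ₓθ`. -/
theorem objective_le_of_subsolution {T : ℝ} {φ₀ u₀ : UnitAddCircle → ℝ}
    (hφ₀ : SmoothOnCircle φ₀) (hmean : ∫ x, φ₀ x = 0) (hu₀ : ∀ x, u₀ x = circleDeriv φ₀ x)
    {θ : ℝ → UnitAddCircle → ℝ} (hθ : Subsolution T φ₀ θ) {ν : Measure (Strip T)}
    {r m : Strip T → ℝ} (hr : Integrable r ν) (hm : Integrable m ν) (hr0 : ∀ z, 0 ≤ r z)
    (hcont : ∀ ψ : ℝ → UnitAddCircle → ℝ, SmoothOnTimeCircle ψ → (∀ x, ψ 0 x = 0) →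
      ∫ z, (dt ψ z.1 z.2 * r z + dx ψ z.1 z.2 * m z) ∂ν = ∫ x, ψ T x) :
    ((∫ z, m z * u₀ z.2 ∂ν : ℝ) : EReal) - ((∫⁻ z, kin (r z) (m z) ∂ν : ℝ≥0∞) : EReal)
      ≤ ((∫ x, -θ T x : ℝ) : EReal) := by
  have hkm : AEMeasurable (fun z => kin (r z) (m z)) ν :=
    measurable_kin.comp_aemeasurable (hr.1.aemeasurable.prodMk hm.1.aemeasurable)
  by_cases hK : ∫⁻ z, kin (r z) (m z) ∂ν = ⊤
  · simp [hK]
  have hfin : ∀ᵐ z ∂ν, kin (r z) (m z) < ⊤ := ae_lt_top' hkm hK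
  rw [← EReal.coe_ennreal_toReal hK, ← integral_toReal hkm hfin, ← EReal.coe_sub,
    EReal.coe_le_coe_iff]
  have hki : Integrable (fun z => (kin (r z) (m z)).toReal) ν :=
    integrable_toReal_of_lintegral_ne_top hkm hK
  have hφT := hφ₀.smoothOnTimeCircle
  have hψ : SmoothOnTimeCircle fun t x => θ t x - φ₀ x := hθ.smooth.sub hφT
  have hdt (t : ℝ) (x : UnitAddCircle) : dt (fun t x => θ t x - φ₀ x) t x = dt θ t x :=
    ((hθ.smooth.hasDerivAt_dt t x).sub_const _).deriv
  have hdx (t : ℝ) (x : UnitAddCircle) :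
      dx (fun t x => θ t x - φ₀ x) t x = dx θ t x - u₀ x := by
    induction x using QuotientAddGroup.induction_on with | H y =>
    rw [hu₀]
    exact (hψ.hasDerivAt_dx t y).unique ((hθ.smooth.hasDerivAt_dx t y).sub (hφ₀.hasDerivAt y))
  have hc := hcont _ hψ (by simp [hθ.initial])
  have hmul {f : ℝ → UnitAddCircle → ℝ} (hf : SmoothOnTimeCircle f) {g : Strip T → ℝ}
      (hg : Integrable g ν) : Integrable (fun z => f z.1 z.2 * g z) ν := by
    have hfc := continuous_strip (T := T) hf.continuous
    obtain ⟨C, hC⟩ := exists_abs_le_of_continuous_strip hfc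
    exact hg.bdd_mul (c := C) hfc.aestronglyMeasurable (Filter.Eventually.of_forall hC)
  have i1 := hmul hψ.dt hr
  have i2 := hmul hψ.dx hm
  have hu : Integrable (fun z => m z * u₀ z.2) ν := by
    have := hmul hφ₀.circleDeriv.smoothOnTimeCircle hm
    simpa only [hu₀, mul_comm] using this
  have hsub : ∫ x, (θ T x - φ₀ x) = ∫ x, θ T x := by
    rw [integral_sub, hmean, sub_zero]
    · exact (hθ.smooth.continuous.comp (continuous_const.prodMk
        continuous_id)).integrable_of_hasCompactSupport (HasCompactSupport.of_compactSpace _)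
    · exact hφ₀.continuous.integrable_of_hasCompactSupport (HasCompactSupport.of_compactSpace _)
  rw [hsub] at hc
  rw [integral_neg, ← hc, ← integral_neg, ← integral_sub hu hki]
  refine integral_mono_ae (hu.sub hki) (i1.add i2).neg ?_
  filter_upwards [hfin] with z hz
  have h1 := mul_sub_le_kin hz.ne (dx θ z.1 z.2)
  have h2 := hθ.hamilton_jacobi z.1 z.1.2 z.2
  have h3 := mul_nonneg (sub_nonneg.2 h2) (hr0 z)
  simp only [hdt, hdx]
  nlinarith

theorem objectiveW_le {T : ℝ} {φ₀ u₀ : UnitAddCircle → ℝ}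
    (hφ₀ : SmoothOnCircle φ₀) (hmean : ∫ x, φ₀ x = 0) (hu₀ : ∀ x, u₀ x = circleDeriv φ₀ x)
    {θ W : ℝ → UnitAddCircle → ℝ} (hT : 0 < T) (hθ : Subsolution T φ₀ θ)
    (hW : AdmissibleW T W) : objectiveW T u₀ W ≤ ((∫ x, -θ T x : ℝ) : EReal) := by
  refine objective_le_of_subsolution hφ₀ hmean hu₀ hθ (r := fun z => 1 - dx W z.1 z.2)
    (m := fun z => dt W z.1 z.2)
    (integrable_strip (continuous_const.sub (continuous_strip hW.smooth.dx.continuous)))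
    (integrable_strip (continuous_strip hW.smooth.dt.continuous))
    (fun z => sub_nonneg.2 (hW.dx_le z.1 z.1.2 z.2)) fun ψ hψ hψ0 => ?_
  exact continuity_potential hT.le hW.smooth hW.final hψ hψ0

theorem absolutelyContinuous_add_totalVariation {X : Type*} [MeasurableSpace X] (ρ : Measure X)
    (q : SignedMeasure X) :
    q ≪ᵥ (ρ + q.totalVariation).toENNRealVectorMeasure := by
  rw [SignedMeasure.absolutelyContinuous_ennreal_iff,
    show (ρ + q.totalVariation).toENNRealVectorMeasure.ennrealToMeasure = ρ + q.totalVariation from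
      VectorMeasure.equivMeasure.right_inv _]
  exact Measure.absolutelyContinuous_of_le (Measure.le_add_left le_rfl)

/-- Integration against `q` in terms of its density with respect to `ρ + |q|`. -/
theorem integral_signedMeasure_eq {T : ℝ} (ρ : Measure (Strip T)) [IsFiniteMeasure ρ]
    (q : SignedMeasure (Strip T)) {f : Strip T → ℝ} (hf : Continuous f) :
    ∫ᵛ z, f z ∂•q
      = ∫ z, q.rnDeriv (ρ + q.totalVariation) z * f z ∂(ρ + q.totalVariation) := by
  obtain ⟨C, hC⟩ := exists_abs_le_of_continuous_strip hf
  conv_lhs => rw [← SignedMeasure.withDensityᵥ_rnDeriv_eq q _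
    (absolutelyContinuous_add_totalVariation ρ q)]
  exact integral_withDensityᵥ (SignedMeasure.integrable_rnDeriv _ _) hf.measurable hC

theorem objectivePair_le {T : ℝ} {φ₀ u₀ : UnitAddCircle → ℝ}
    (hφ₀ : SmoothOnCircle φ₀) (hmean : ∫ x, φ₀ x = 0) (hu₀ : ∀ x, u₀ x = circleDeriv φ₀ x)
    {θ : ℝ → UnitAddCircle → ℝ} (hθ : Subsolution T φ₀ θ)
    {ρ : Measure (Strip T)} {q : SignedMeasure (Strip T)} (h : AdmissiblePair T ρ q) :
    objectivePair u₀ ρ q ≤ ((∫ x, -θ T x : ℝ) : EReal) := by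
  have := h.finite
  have hu : Continuous u₀ := by
    rw [funext hu₀]; exact hφ₀.circleDeriv.continuous
  have hac : ρ ≪ ρ + q.totalVariation :=
    Measure.absolutelyContinuous_of_le (Measure.le_add_right le_rfl)
  rw [objectivePair, integral_signedMeasure_eq ρ q (f := fun z => u₀ z.2) (hu.comp continuous_snd),
    kineticEnergy]
  refine objective_le_of_subsolution hφ₀ hmean hu₀ hθ
    (r := fun z => (ρ.rnDeriv (ρ + q.totalVariation) z).toReal)
    Measure.integrable_toReal_rnDeriv (SignedMeasure.integrable_rnDeriv _ _)
    (fun z => ENNReal.toReal_nonneg) fun ψ hψ hψ0 => ?_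
  have hct := continuous_strip (T := T) hψ.dt.continuous
  have hcx := continuous_strip (T := T) hψ.dx.continuous
  obtain ⟨C, hC⟩ := exists_abs_le_of_continuous_strip hct
  obtain ⟨C', hC'⟩ := exists_abs_le_of_continuous_strip hcx
  rw [integral_add, ← h.continuity ψ hψ hψ0, ← integral_rnDeriv_smul hac,
    integral_signedMeasure_eq ρ q hcx]
  · simp only [smul_eq_mul, mul_comm]
  · exact Measure.integrable_toReal_rnDeriv.bdd_mul (c := C) hct.aestronglyMeasurable
      (Filter.Eventually.of_forall hC)
  · exact (SignedMeasure.integrable_rnDeriv _ _).bdd_mul (c := C') hcx.aestronglyMeasurable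
      (Filter.Eventually.of_forall hC')

/-- The kinetic energy of `(ρ, vρ)` is `∫ v² / 2 dρ`. -/
theorem kineticEnergy_withDensityᵥ {T : ℝ} {ρ : Measure (Strip T)} [IsFiniteMeasure ρ]
    {v : Strip T → ℝ} (hv : Integrable v ρ) (hvm : Measurable v) :
    kineticEnergy ρ (ρ.withDensityᵥ v) = ∫⁻ z, ENNReal.ofReal (1 / 2 * v z ^ 2) ∂ρ := by
  set q : SignedMeasure (Strip T) := ρ.withDensityᵥ v
  have hac : ρ ≪ ρ + q.totalVariation :=
    Measure.absolutelyContinuous_of_le (Measure.le_add_right le_rfl)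
  have h1 : q.rnDeriv (ρ + q.totalVariation) =ᵐ[ρ + q.totalVariation]
      fun z => (ρ.rnDeriv (ρ + q.totalVariation) z).toReal • v z := by
    refine Integrable.ae_eq_of_withDensityᵥ_eq (SignedMeasure.integrable_rnDeriv _ _)
      ((integrable_rnDeriv_smul_iff hac).2 hv) ?_
    rw [SignedMeasure.withDensityᵥ_rnDeriv_eq q _ (absolutelyContinuous_add_totalVariation ρ q),
      withDensityᵥ_rnDeriv_smul hac hv]
  rw [kineticEnergy, ← lintegral_rnDeriv_mul hac (by fun_prop)]
  refine lintegral_congr_ae ?_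
  filter_upwards [h1, ρ.rnDeriv_lt_top (ρ + q.totalVariation)] with z hz hz'
  rw [hz, smul_eq_mul, kin_self_mul ENNReal.toReal_nonneg, ENNReal.ofReal_toReal hz'.ne]

/-! ### The Hopf–Lax velocity -/

/-- A measurable choice of minimizing velocities in the Hopf–Lax formula at time `T`. Any choice
of minimizers will do: the foot points `s - T V(s)` are nondecreasing in `s`, by exchanging the
foot points of two crossing trajectories, hence measurable. -/
theorem exists_measurable_minimizer {φ₀ : UnitAddCircle → ℝ} (hφ₀ : Continuous φ₀) {T R : ℝ}
    (hT : 0 < T) (hR : 0 ≤ R) :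
    ∃ V : UnitAddCircle → ℝ, Measurable V ∧ (∀ x, |V x| ≤ R) ∧ ∀ x w, |w| ≤ R →
      φ₀ (x - ((T * V x : ℝ) : UnitAddCircle)) + T / 2 * V x ^ 2
        ≤ φ₀ (x - ((T * w : ℝ) : UnitAddCircle)) + T / 2 * w ^ 2 := by
  have hex (x : UnitAddCircle) : ∃ w ∈ Set.Icc (-R) R, ∀ w' ∈ Set.Icc (-R) R,
      φ₀ (x - ((T * w : ℝ) : UnitAddCircle)) + T / 2 * w ^ 2
        ≤ φ₀ (x - ((T * w' : ℝ) : UnitAddCircle)) + T / 2 * w' ^ 2 := by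
    have : Continuous fun w : ℝ => ((T * w : ℝ) : UnitAddCircle) :=
      (AddCircle.continuous_mk' 1).comp (continuous_const.mul continuous_id)
    have hc : Continuous fun w : ℝ =>
        φ₀ (x - ((T * w : ℝ) : UnitAddCircle)) + T / 2 * w ^ 2 := by fun_prop
    exact isCompact_Icc.exists_isMinOn ⟨0, neg_nonpos.2 hR, hR⟩ hc.continuousOn
  choose V hV hmin using hex
  refine ⟨V, ?_, fun x => abs_le.2 (hV x), fun x w hw => hmin x w (abs_le.1 hw)⟩
  have hmono : Monotone fun s : ℝ => s - T * V (s : UnitAddCircle) := by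
    intro s₁ s₂ hs
    -- crossing trajectories: compare each minimizer with the other foot point
    by_contra! hlt
    rcases hs.eq_or_lt with rfl | hs
    · exact lt_irrefl _ hlt
    obtain ⟨l1, u1⟩ := hV (s₁ : UnitAddCircle)
    obtain ⟨l2, u2⟩ := hV (s₂ : UnitAddCircle)
    have h1 := hmin (s₁ : UnitAddCircle) ((s₁ - (s₂ - T * V s₂)) / T) ⟨by
      rw [le_div_iff₀ hT]; nlinarith, by rw [div_le_iff₀ hT]; nlinarith⟩
    have h2 := hmin (s₂ : UnitAddCircle) ((s₂ - (s₁ - T * V s₁)) / T) ⟨by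
      rw [le_div_iff₀ hT]; nlinarith, by rw [div_le_iff₀ hT]; nlinarith⟩
    rw [mul_div_cancel₀ _ hT.ne', ← AddCircle.coe_sub, ← AddCircle.coe_sub,
      sub_sub_cancel] at h1 h2
    have h3 := add_le_add h1 h2
    generalize V (s₁ : UnitAddCircle) = v₁ at *
    generalize V (s₂ : UnitAddCircle) = v₂ at *
    have h4 : T / 2 * v₁ ^ 2 + T / 2 * v₂ ^ 2
        ≤ T / 2 * ((s₁ - (s₂ - T * v₂)) / T) ^ 2 + T / 2 * ((s₂ - (s₁ - T * v₁)) / T) ^ 2 := by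
      linarith
    field_simp at h4
    nlinarith [mul_pos (sub_pos.2 hs) (sub_pos.2 hlt)]
  have hlift : Measurable fun s : ℝ => V (s : UnitAddCircle) := by
    have : (fun s : ℝ => V (s : UnitAddCircle))
        = fun s : ℝ => (s - (s - T * V (s : UnitAddCircle))) / T := by
      ext s; field_simp; ring
    rw [this]
    exact (measurable_id.sub hmono.measurable).div_const T
  have : V = fun x => V (((AddCircle.measurableEquivIoc 1 0 x : ℝ)) : UnitAddCircle) := by
    ext x
    congr 1
    exact (AddCircle.coe_equivIoc (p := (1 : ℝ)) (a := 0)).symm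
  rw [this]
  exact hlift.comp (measurable_subtype_coe.comp (MeasurableEquiv.measurable _))

/-- The position at time `t` of the straight trajectory which ends at `y` at time `T`. -/
noncomputable def position (T : ℝ) (V : UnitAddCircle → ℝ) (t : ℝ) (y : UnitAddCircle) :
    UnitAddCircle :=
  y - (((T - t) * V y : ℝ) : UnitAddCircle)

theorem measurable_position {T : ℝ} {V : UnitAddCircle → ℝ} (hV : Measurable V) :
    Measurable fun p : ℝ × UnitAddCircle => position T V p.1 p.2 :=
  measurable_snd.sub ((AddCircle.continuous_mk' 1).measurable.comp
    ((measurable_const.sub measurable_fst).mul (hV.comp measurable_snd)))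

/-- The straight-line flow on the strip, as a map from the labels `(t, y)`, where `y` is the end
point of a trajectory at time `T`, to the points `(t, position T V t y)`. -/
noncomputable def flow (T : ℝ) (V : UnitAddCircle → ℝ) (z : Strip T) : Strip T :=
  (z.1, position T V z.1 z.2)

theorem measurable_flow {T : ℝ} {V : UnitAddCircle → ℝ} (hV : Measurable V) :
    Measurable (flow T V) :=
  measurable_fst.prodMk ((measurable_position hV).comp
    (f := fun z : Strip T => ((z.1 : ℝ), z.2))
    ((measurable_subtype_coe.comp measurable_fst).prodMk measurable_snd))

/-- The chain rule along one trajectory of the flow. -/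
theorem integral_along_trajectory {ψ : ℝ → UnitAddCircle → ℝ} (hψ : SmoothOnTimeCircle ψ)
    (T w : ℝ) (x : UnitAddCircle) :
    ∫ t in (0 : ℝ)..T, (dt ψ t (x - (((T - t) * w : ℝ) : UnitAddCircle))
        + w * dx ψ t (x - (((T - t) * w : ℝ) : UnitAddCircle)))
      = ψ T x - ψ 0 (x - ((T * w : ℝ) : UnitAddCircle)) := by
  induction x using QuotientAddGroup.induction_on with | H y =>
  change ∫ t in (0 : ℝ)..T, (dt ψ t ((y : UnitAddCircle) - (((T - t) * w : ℝ) : UnitAddCircle))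
        + w * dx ψ t ((y : UnitAddCircle) - (((T - t) * w : ℝ) : UnitAddCircle)))
      = ψ T (y : UnitAddCircle) - ψ 0 ((y : UnitAddCircle) - ((T * w : ℝ) : UnitAddCircle))
  simp_rw [← AddCircle.coe_sub]
  have hc {f : ℝ → UnitAddCircle → ℝ} (hf : SmoothOnTimeCircle f) :
      Continuous fun t => f t ((y - (T - t) * w : ℝ) : UnitAddCircle) :=
    (ContDiff.continuous hf).comp (f := fun t : ℝ => (t, y - (T - t) * w)) (by fun_prop)
  rw [intervalIntegral.integral_eq_sub_of_hasDerivAt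
    (f := fun t => ψ t ((y - (T - t) * w : ℝ) : UnitAddCircle))]
  · simp
  · intro t _
    have h1 : HasDerivAt (fun t : ℝ => (t, y - (T - t) * w)) ((1 : ℝ), w) t := by
      refine (hasDerivAt_id t).prodMk ?_
      simpa using (((hasDerivAt_id t).const_sub T).mul_const w).const_sub y
    have h2 : HasDerivAt (fun t => ψ t ((y - (T - t) * w : ℝ) : UnitAddCircle)) _ t :=
      HasFDerivAt.comp_hasDerivAt t (hψ.hasFDerivAt _) h1
    refine h2.congr_deriv ?_
    rw [hψ.dt_coe, hψ.dx_coe, ← smul_eq_mul w (fderiv ℝ _ _ _), ← map_smul, ← map_add]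
    simp
  · exact ((hc hψ.dt).add (continuous_const.mul (hc hψ.dx))).intervalIntegrable _ _

/-- The chain rule along the flow, integrated over all trajectories. -/
theorem integral_along_flow {T R : ℝ} (hT : 0 ≤ T) {V : UnitAddCircle → ℝ} (hV : Measurable V)
    (hR : ∀ x, |V x| ≤ R) {ψ : ℝ → UnitAddCircle → ℝ} (hψ : SmoothOnTimeCircle ψ) :
    ∫ z, dt ψ (flow T V z).1 (flow T V z).2 ∂(stripVolume T)
      + ∫ z, V z.2 * dx ψ (flow T V z).1 (flow T V z).2 ∂(stripVolume T)
      = ∫ x, (ψ T x - ψ 0 (x - ((T * V x : ℝ) : UnitAddCircle))) := by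
  have hi {f : ℝ → UnitAddCircle → ℝ} (hf : SmoothOnTimeCircle f) :
      Integrable (fun z => f (flow T V z).1 (flow T V z).2) (stripVolume T) := by
    have hfc := continuous_strip (T := T) hf.continuous
    obtain ⟨C, hC⟩ := exists_abs_le_of_continuous_strip hfc
    exact Integrable.of_bound (hfc.measurable.comp (measurable_flow hV)).aestronglyMeasurable C
      (Filter.Eventually.of_forall fun z => hC (flow T V z))
  have hi' : Integrable (fun z => V z.2 * dx ψ (flow T V z).1 (flow T V z).2) (stripVolume T) :=
    (hi hψ.dx).bdd_mul (c := R) (hV.comp measurable_snd).aestronglyMeasurable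
      (Filter.Eventually.of_forall fun z => hR z.2)
  rw [← integral_add (hi hψ.dt) hi']
  have := integral_strip hT (f := fun t x =>
    dt ψ t (position T V t x) + V x * dx ψ t (position T V t x)) ((hi hψ.dt).add hi')
  refine this.trans ?_
  congr 1; ext x
  exact integral_along_trajectory hψ T (V x) x

/-- Conditional expectation along a map `G`, as a bounded density on the target: the image under
`G` of the signed measure `V π` has a density with respect to the image of `π`. -/
theorem exists_density_map {X Y : Type*} [MeasurableSpace X] [MeasurableSpace Y] {π : Measure X}
    [IsFiniteMeasure π] {G : X → Y} (hG : Measurable G) {V : X → ℝ} (hV : Measurable V) {R : ℝ}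
    (hR0 : 0 ≤ R) (hR : ∀ x, |V x| ≤ R) :
    ∃ v : Y → ℝ, Measurable v ∧ (∀ y, |v y| ≤ R) ∧
      ∀ (f : Y → ℝ) (C : ℝ), Measurable f → (∀ y, |f y| ≤ C) →
        ∫ y, v y * f y ∂(π.map G) = ∫ x, V x * f (G x) ∂π := by
  have hle : (inferInstance : MeasurableSpace Y).comap G ≤ (inferInstance : MeasurableSpace X) :=
    hG.comap_le
  have hVi : Integrable V π := Integrable.of_bound hV.aestronglyMeasurable R
    (Filter.Eventually.of_forall hR)
  obtain ⟨h, hm, hh⟩ := (stronglyMeasurable_condExp (μ := π) (f := V)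
    (m := (inferInstance : MeasurableSpace Y).comap G)).exists_eq_measurable_comp
  have hbd := ae_bdd_abs_condExp_of_ae_bdd_abs (μ := π) (f := V) (R := R)
    (m := (inferInstance : MeasurableSpace Y).comap G) (Filter.Eventually.of_forall hR)
  refine ⟨fun y => max (-R) (min R (h y)), by fun_prop, fun y => abs_le.2 ⟨le_max_left _ _,
    max_le (by linarith) (min_le_left _ _)⟩, fun f C hf hC => ?_⟩
  have hfm : StronglyMeasurable[(inferInstance : MeasurableSpace Y).comap G] (f ∘ G) :=
    (hf.comp (comap_measurable G)).stronglyMeasurable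
  have hfV : Integrable ((f ∘ G) * V) π :=
    hVi.bdd_mul (c := C) (hf.comp hG).aestronglyMeasurable
      (Filter.Eventually.of_forall fun x => hC (G x))
  have hpull := condExp_mul_of_stronglyMeasurable_left hfm hfV hVi
  rw [integral_map hG.aemeasurable (by fun_prop)]
  have : ∫ x, V x * f (G x) ∂π = ∫ x, ((f ∘ G) * V) x ∂π := by
    congr 1; ext x; simp [mul_comm]
  rw [this, ← integral_condExp hle (f := (f ∘ G) * V)]
  refine integral_congr_ae ?_
  filter_upwards [hpull, hbd] with x hx hb
  rw [hx, Pi.mul_apply, mul_comm, hh]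
  rw [hh] at hb
  simp only [Function.comp_apply] at hb ⊢
  have hb' := abs_le.1 hb
  rw [min_eq_right hb'.2, max_eq_right hb'.1]

/-! ### The optimal pair of measures -/

theorem objectivePair_withDensityᵥ {T : ℝ} {u₀ : UnitAddCircle → ℝ} (hu : Continuous u₀)
    {ρ : Measure (Strip T)} [IsFiniteMeasure ρ] {v : Strip T → ℝ} (hvm : Measurable v) {R : ℝ}
    (hv : ∀ z, |v z| ≤ R) :
    objectivePair u₀ ρ (ρ.withDensityᵥ v)
      = ((∫ z, (-(1 / 2) * v z ^ 2 + v z * u₀ z.2) ∂ρ : ℝ) : EReal) := by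
  have hvi : Integrable v ρ := Integrable.of_bound hvm.aestronglyMeasurable R
    (Filter.Eventually.of_forall hv)
  have huc : Continuous fun z : Strip T => u₀ z.2 := hu.comp continuous_snd
  obtain ⟨C, hC⟩ := exists_abs_le_of_continuous_strip huc
  have h1 : Integrable (fun z => 1 / 2 * v z ^ 2) ρ := by
    simp_rw [pow_two]
    exact (hvi.bdd_mul (c := R) hvm.aestronglyMeasurable
      (Filter.Eventually.of_forall hv)).const_mul _
  have h2 : Integrable (fun z => v z * u₀ z.2) ρ :=
    hvi.mul_bdd (c := C) huc.aestronglyMeasurable (Filter.Eventually.of_forall hC)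
  rw [objectivePair, kineticEnergy_withDensityᵥ hvi hvm,
    integral_withDensityᵥ hvi huc.measurable hC,
    ← ofReal_integral_eq_lintegral_ofReal h1 (Filter.Eventually.of_forall fun z => by positivity),
    EReal.coe_ennreal_ofReal, max_eq_left (integral_nonneg fun z => by positivity),
    ← EReal.coe_sub, ← integral_sub h2 h1]
  congr 2; ext z; ring

/-- The image of `dt dx` under the flow of the Hopf–Lax velocity, together with the image of the
momentum, is an admissible pair which does at least as well as the Hopf–Lax value. -/
theorem exists_admissiblePair {T R : ℝ} (hT : 0 < T) (hR0 : 0 ≤ R) {φ₀ u₀ : UnitAddCircle → ℝ}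
    (hφ₀ : SmoothOnCircle φ₀) (hu₀ : ∀ x, u₀ x = circleDeriv φ₀ x)
    {V : UnitAddCircle → ℝ} (hV : Measurable V) (hR : ∀ x, |V x| ≤ R) :
    ∃ (ρ : Measure (Strip T)) (v : Strip T → ℝ), IsFiniteMeasure ρ ∧ Measurable v ∧
      (∀ z, |v z| ≤ R) ∧ AdmissiblePair T ρ (ρ.withDensityᵥ v) ∧
      ∫ z : Strip T, (V z.2 * u₀ (flow T V z).2 - 1 / 2 * V z.2 ^ 2) ∂(stripVolume T)
        ≤ ∫ z, (-(1 / 2) * v z ^ 2 + v z * u₀ z.2) ∂ρ := by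
  have hVm : Measurable fun z : Strip T => V z.2 := hV.comp measurable_snd
  have hG := measurable_flow (T := T) hV
  obtain ⟨v, hvm, hvR, hv⟩ := exists_density_map (π := stripVolume T) hG hVm hR0
    (fun z => hR z.2)
  have hfin : IsFiniteMeasure ((stripVolume T).map (flow T V)) := inferInstance
  have hu : Continuous u₀ := by rw [funext hu₀]; exact hφ₀.circleDeriv.continuous
  have huc : Continuous fun z : Strip T => u₀ z.2 := hu.comp continuous_snd
  have hvi : Integrable v ((stripVolume T).map (flow T V)) :=
    Integrable.of_bound hvm.aestronglyMeasurable R (Filter.Eventually.of_forall hvR)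
  refine ⟨(stripVolume T).map (flow T V), v, hfin, hvm, hvR, ⟨hfin, fun ψ hψ hψ0 => ?_⟩, ?_⟩
  · have hcx := continuous_strip (T := T) hψ.dx.continuous
    have hct := continuous_strip (T := T) hψ.dt.continuous
    obtain ⟨C, hC⟩ := exists_abs_le_of_continuous_strip hcx
    rw [integral_withDensityᵥ hvi hcx.measurable hC, hv _ C hcx.measurable hC,
      integral_map hG.aemeasurable hct.aestronglyMeasurable,
      integral_along_flow hT.le hV hR hψ]
    simp [hψ0]
  · obtain ⟨C, hC⟩ := exists_abs_le_of_continuous_strip huc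
    have bdd {X : Type} [MeasurableSpace X] {μ : Measure X} [IsFiniteMeasure μ] {f g : X → ℝ}
        {A B : ℝ} (hf : Measurable f) (hg : Measurable g) (hA : ∀ x, |f x| ≤ A)
        (hB : ∀ x, |g x| ≤ B) : Integrable (fun x => f x * g x) μ :=
      (Integrable.of_bound hg.aestronglyMeasurable B (Filter.Eventually.of_forall hB)).bdd_mul
        (c := A) hf.aestronglyMeasurable (Filter.Eventually.of_forall hA)
    have e1 := hv _ C huc.measurable hC
    have e2 := hv _ R hvm hvR
    have e3 : ∫ z, v z * v z ∂((stripVolume T).map (flow T V))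
        = ∫ z, v (flow T V z) * v (flow T V z) ∂(stripVolume T) :=
      integral_map hG.aemeasurable (hvm.mul hvm).aestronglyMeasurable
    have i1 : Integrable (fun z => V z.2 * u₀ (flow T V z).2) (stripVolume T) :=
      bdd hVm (huc.measurable.comp hG) (fun z => hR z.2) (fun z => hC (flow T V z))
    have i2 := bdd (μ := stripVolume T) hVm hVm (fun z => hR z.2) (fun z => hR z.2)
    have i3 := bdd (μ := (stripVolume T).map (flow T V)) hvm hvm hvR hvR
    have i4 := bdd (μ := (stripVolume T).map (flow T V)) hvm huc.measurable hvR hC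
    have i5 : Integrable (fun z => V z.2 * v (flow T V z)) (stripVolume T) :=
      bdd hVm (hvm.comp hG) (fun z => hR z.2) (fun z => hvR (flow T V z))
    have i6 : Integrable (fun z => v (flow T V z) * v (flow T V z)) (stripVolume T) :=
      bdd (hvm.comp hG) (hvm.comp hG) (fun z => hvR (flow T V z)) (fun z => hvR (flow T V z))
    -- the conditional expectation does not increase the second moment
    have hsq : 0 ≤ ∫ z : Strip T, ((V z.2 * V z.2 - 2 * (V z.2 * v (flow T V z)))
        + v (flow T V z) * v (flow T V z)) ∂(stripVolume T) :=
      integral_nonneg fun z => by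
        have := sq_nonneg (V z.2 - v (flow T V z))
        simp only [Pi.zero_apply]; nlinarith
    have hsplit : ∫ z : Strip T, ((V z.2 * V z.2 - 2 * (V z.2 * v (flow T V z)))
        + v (flow T V z) * v (flow T V z)) ∂(stripVolume T)
        = ∫ z : Strip T, V z.2 * V z.2 ∂(stripVolume T)
          - 2 * ∫ z : Strip T, V z.2 * v (flow T V z) ∂(stripVolume T)
          + ∫ z : Strip T, v (flow T V z) * v (flow T V z) ∂(stripVolume T) := by
      rw [integral_add (by simpa using! i2.sub (i5.const_mul 2)) i6,
        integral_sub i2 (i5.const_mul 2), integral_const_mul]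
    have l1 : ∫ z : Strip T, (V z.2 * u₀ (flow T V z).2 - 1 / 2 * V z.2 ^ 2) ∂(stripVolume T)
        = ∫ z : Strip T, V z.2 * u₀ (flow T V z).2 ∂(stripVolume T)
          - 1 / 2 * ∫ z : Strip T, V z.2 * V z.2 ∂(stripVolume T) := by
      simp_rw [pow_two]
      rw [integral_sub i1 (i2.const_mul _), integral_const_mul]
    have l2 : ∫ z, (-(1 / 2) * v z ^ 2 + v z * u₀ z.2) ∂((stripVolume T).map (flow T V))
        = -(1 / 2) * ∫ z, v z * v z ∂((stripVolume T).map (flow T V))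
          + ∫ z, v z * u₀ z.2 ∂((stripVolume T).map (flow T V)) := by
      simp_rw [pow_two]
      rw [integral_add (i3.const_mul _) i4, integral_const_mul]
    rw [l1, l2, e1]
    linarith

/-- The action of the flow, in terms of the values of `φ₀` at the two ends of the trajectories. -/
theorem integral_action_flow {T R : ℝ} (hT : 0 < T) {φ₀ u₀ : UnitAddCircle → ℝ}
    (hφ₀ : SmoothOnCircle φ₀) (hmean : ∫ x, φ₀ x = 0) (hu₀ : ∀ x, u₀ x = circleDeriv φ₀ x)
    {V : UnitAddCircle → ℝ} (hV : Measurable V) (hR : ∀ x, |V x| ≤ R) :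
    ∫ z : Strip T, (V z.2 * u₀ (flow T V z).2 - 1 / 2 * V z.2 ^ 2) ∂(stripVolume T)
      = ∫ x, -(φ₀ (x - ((T * V x : ℝ) : UnitAddCircle)) + T / 2 * V x ^ 2) := by
  have hu : Continuous u₀ := by rw [funext hu₀]; exact hφ₀.circleDeriv.continuous
  have hVm : Measurable fun z : Strip T => V z.2 := hV.comp measurable_snd
  have hG := measurable_flow (T := T) hV
  have huc : Continuous fun z : Strip T => u₀ z.2 := hu.comp continuous_snd
  obtain ⟨C, hC⟩ := exists_abs_le_of_continuous_strip huc
  obtain ⟨B, -, hB⟩ := exists_abs_le_of_continuous hφ₀.continuous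
  have hVx : Integrable V (volume : Measure UnitAddCircle) :=
    Integrable.of_bound hV.aestronglyMeasurable R (Filter.Eventually.of_forall hR)
  have hVs : Integrable (fun z : Strip T => V z.2) (stripVolume T) :=
    Integrable.of_bound hVm.aestronglyMeasurable R (Filter.Eventually.of_forall fun z => hR z.2)
  have i1 : Integrable (fun z : Strip T => V z.2 * u₀ (flow T V z).2) (stripVolume T) :=
    hVs.mul_bdd (c := C) (huc.measurable.comp hG).aestronglyMeasurable
      (Filter.Eventually.of_forall fun z => hC (flow T V z))
  have i2 : Integrable (fun z : Strip T => 1 / 2 * V z.2 ^ 2) (stripVolume T) := by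
    simp_rw [pow_two]
    exact (hVs.bdd_mul (c := R) hVm.aestronglyMeasurable
      (Filter.Eventually.of_forall fun z => hR z.2)).const_mul _
  have i3 : Integrable (fun x => T / 2 * V x ^ 2) (volume : Measure UnitAddCircle) := by
    simp_rw [pow_two]
    exact (hVx.bdd_mul (c := R) hV.aestronglyMeasurable
      (Filter.Eventually.of_forall hR)).const_mul _
  have hfoot : Measurable fun x => φ₀ (x - ((T * V x : ℝ) : UnitAddCircle)) :=
    hφ₀.continuous.measurable.comp (measurable_id.sub
      ((AddCircle.continuous_mk' 1).measurable.comp (measurable_const.mul hV)))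
  have i4 : Integrable (fun x => φ₀ (x - ((T * V x : ℝ) : UnitAddCircle)))
      (volume : Measure UnitAddCircle) :=
    Integrable.of_bound hfoot.aestronglyMeasurable B (Filter.Eventually.of_forall fun x => hB _)
  have i5 : Integrable φ₀ (volume : Measure UnitAddCircle) :=
    Integrable.of_bound hφ₀.continuous.aestronglyMeasurable B (Filter.Eventually.of_forall hB)
  have h1 := integral_along_flow hT.le hV hR hφ₀.smoothOnTimeCircle
  have hdt (t : ℝ) (x : UnitAddCircle) : dt (fun _ x => φ₀ x) t x = 0 := by simp [dt]
  have hdx (t : ℝ) (x : UnitAddCircle) : dx (fun _ x => φ₀ x) t x = u₀ x := (hu₀ x).symm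
  simp_rw [hdt, hdx] at h1
  rw [integral_zero, zero_add, integral_sub i5 i4, hmean, zero_sub] at h1
  have h2 := integral_strip hT.le (f := fun _ x => 1 / 2 * V x ^ 2) i2
  simp only [intervalIntegral.integral_const, sub_zero, smul_eq_mul] at h2
  rw [integral_sub i1 i2, h1, integral_neg, integral_add i4 i3, h2, neg_add, ← sub_eq_add_neg]
  congr 2
  ext x; ring

/-! ### Smooth subsolutions from a soft minimum in the Hopf–Lax formula -/

/-- The Gibbs weight `exp (-S / ε)` of the velocity `v`, where `S = φ₀(y - tv) + tv²/2` is the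
quantity minimized in the Hopf–Lax formula. It is smooth in `(t, y, v)` for all real `t`. -/
noncomputable def gibbs (φ₀ : UnitAddCircle → ℝ) (ε t y v : ℝ) : ℝ :=
  Real.exp (-(φ₀ ((y - t * v : ℝ) : UnitAddCircle) + t / 2 * v ^ 2) / ε)

/-- The partition function of the Gibbs weights over the velocities in `(-R, R]`. -/
noncomputable def partitionFn (φ₀ : UnitAddCircle → ℝ) (ε R t : ℝ) (x : UnitAddCircle) : ℝ :=
  ∫ v in Set.Ioc (-R) R,
    Real.exp (-(φ₀ (x - ((t * v : ℝ) : UnitAddCircle)) + t / 2 * v ^ 2) / ε)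

/-- The soft minimum `-ε log` of the averaged Gibbs weights, lowered by an amount depending on
time only. The correction `(K/2) ε arsinh (t/ε)` vanishes at `t = 0`, tends to `0` with `ε`, is
smooth on the whole line, and its derivative is at least `(K/2) ε / (t + ε)` for `t ≥ 0`. -/
noncomputable def softHopfLax (φ₀ : UnitAddCircle → ℝ) (ε R K t : ℝ) (x : UnitAddCircle) : ℝ :=
  -ε * Real.log (partitionFn φ₀ ε R t x / (2 * R)) - K / 2 * ε * Real.arsinh (t / ε)

theorem gibbs_pos (φ₀ : UnitAddCircle → ℝ) (ε t y v : ℝ) : 0 < gibbs φ₀ ε t y v := Real.exp_pos _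

theorem partitionFn_coe (φ₀ : UnitAddCircle → ℝ) (ε R t y : ℝ) :
    partitionFn φ₀ ε R t (y : UnitAddCircle) = ∫ v in Set.Ioc (-R) R, gibbs φ₀ ε t y v := rfl

theorem contDiff_gibbs {φ₀ : UnitAddCircle → ℝ} (hφ₀ : SmoothOnCircle φ₀)
    (ε : ℝ) :
    ContDiff ℝ ∞ fun z : (ℝ × ℝ) × ℝ => gibbs φ₀ ε z.1.1 z.1.2 z.2 := by
  have h : ContDiff ℝ ∞ fun z : (ℝ × ℝ) × ℝ =>
      φ₀ ((z.1.2 - z.1.1 * z.2 : ℝ) : UnitAddCircle) :=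
    ContDiff.comp (g := fun s : ℝ => φ₀ (s : UnitAddCircle)) hφ₀ (by fun_prop)
  have h2 : ContDiff ℝ ∞ fun z : (ℝ × ℝ) × ℝ => z.1.1 / 2 * z.2 ^ 2 := by fun_prop
  exact ((h.add h2).neg.div_const ε).exp

theorem continuous_gibbs {φ₀ : UnitAddCircle → ℝ} (hφ₀ : SmoothOnCircle φ₀)
    (ε t y : ℝ) : Continuous fun v => gibbs φ₀ ε t y v :=
  (contDiff_gibbs hφ₀ ε).continuous.comp (f := fun v : ℝ => ((t, y), v)) (by fun_prop)

theorem continuous_circleDeriv_foot {φ₀ : UnitAddCircle → ℝ} (hφ₀ : SmoothOnCircle φ₀)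
    (t y : ℝ) :
    Continuous fun v : ℝ => circleDeriv φ₀ ((y - t * v : ℝ) : UnitAddCircle) :=
  (ContDiff.continuous hφ₀.circleDeriv).comp (f := fun v : ℝ => y - t * v) (by fun_prop)

theorem hasDerivAt_gibbs_time {φ₀ : UnitAddCircle → ℝ} (hφ₀ : SmoothOnCircle φ₀)
    (ε t y v : ℝ) :
    HasDerivAt (fun s => gibbs φ₀ ε s y v)
      (gibbs φ₀ ε t y v * (-(v ^ 2 / 2 - v * circleDeriv φ₀ ((y - t * v : ℝ) : UnitAddCircle)) / ε))
      t := by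
  have h1 : HasDerivAt (fun s : ℝ => y - s * v) (-v) t := by
    simpa using ((hasDerivAt_id t).mul_const v).const_sub y
  have h2 := (hφ₀.hasDerivAt (y - t * v)).comp t h1
  have h3 : HasDerivAt (fun s : ℝ => s / 2 * v ^ 2) (1 / 2 * v ^ 2) t :=
    ((hasDerivAt_id t).div_const 2).mul_const _
  refine (((h2.add h3).neg.div_const ε).exp).congr_deriv ?_
  simp only [gibbs, Function.comp_apply, Pi.add_apply, Pi.neg_apply]
  ring

theorem hasDerivAt_gibbs_space {φ₀ : UnitAddCircle → ℝ} (hφ₀ : SmoothOnCircle φ₀)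
    (ε t y v : ℝ) :
    HasDerivAt (fun s => gibbs φ₀ ε t s v)
      (gibbs φ₀ ε t y v * (-circleDeriv φ₀ ((y - t * v : ℝ) : UnitAddCircle) / ε)) y := by
  have h2 := (hφ₀.hasDerivAt (y - t * v)).comp y ((hasDerivAt_id y).sub_const (t * v))
  refine (((h2.add_const (t / 2 * v ^ 2)).neg.div_const ε).exp).congr_deriv ?_
  simp only [gibbs, Function.comp_apply, Pi.neg_apply, id]
  ring

theorem hasDerivAt_gibbs_velocity {φ₀ : UnitAddCircle → ℝ} (hφ₀ : SmoothOnCircle φ₀)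
    (ε t y v : ℝ) :
    HasDerivAt (fun w => gibbs φ₀ ε t y w)
      (gibbs φ₀ ε t y v
        * (-(t * (v - circleDeriv φ₀ ((y - t * v : ℝ) : UnitAddCircle))) / ε)) v := by
  have h1 : HasDerivAt (fun w : ℝ => y - t * w) (-t) v := by
    simpa using ((hasDerivAt_id v).const_mul t).const_sub y
  have h2 := (hφ₀.hasDerivAt (y - t * v)).comp v h1
  have h3 : HasDerivAt (fun w : ℝ => t / 2 * w ^ 2) (t / 2 * (2 * v)) v := by
    simpa using ((hasDerivAt_id v).pow 2).const_mul (t / 2)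
  refine (((h2.add h3).neg.div_const ε).exp).congr_deriv ?_
  simp only [gibbs, Function.comp_apply, Pi.add_apply, Pi.neg_apply]
  ring

/-- The concentration estimate: integrate the `v`-derivative of `(v - φ₀'(y - tv)) exp (-S / ε)`
over the velocities. As `R` bounds `|φ₀'|`, both boundary terms have a favourable sign. -/
theorem mul_integral_sq_gibbs_le {φ₀ : UnitAddCircle → ℝ} (hφ₀ : SmoothOnCircle φ₀)
    {ε R C t y : ℝ} (hε : 0 < ε) (ht : 0 ≤ t)
    (hR0 : 0 ≤ R) (hR : ∀ x, |circleDeriv φ₀ x| ≤ R)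
    (hC : ∀ x, |circleDeriv (circleDeriv φ₀) x| ≤ C) :
    t * ∫ v in Set.Ioc (-R) R,
        (v - circleDeriv φ₀ ((y - t * v : ℝ) : UnitAddCircle)) ^ 2 * gibbs φ₀ ε t y v
      ≤ ε * ((1 + t * C) * ∫ v in Set.Ioc (-R) R, gibbs φ₀ ε t y v) := by
  set u : ℝ → ℝ := fun v => circleDeriv φ₀ ((y - t * v : ℝ) : UnitAddCircle) with hu
  set u' : ℝ → ℝ := fun v => circleDeriv (circleDeriv φ₀) ((y - t * v : ℝ) : UnitAddCircle) with hu'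
  set g : ℝ → ℝ := fun v => gibbs φ₀ ε t y v with hg
  have hgc : Continuous g := continuous_gibbs hφ₀ ε t y
  have huc : Continuous u := continuous_circleDeriv_foot hφ₀ t y
  have huc' : Continuous u' := continuous_circleDeriv_foot hφ₀.circleDeriv t y
  have hg0 (v : ℝ) : 0 < g v := gibbs_pos φ₀ ε t y v
  have hd (v : ℝ) : HasDerivAt (fun v => (v - u v) * g v)
      ((1 + t * u' v) * g v - t / ε * ((v - u v) ^ 2 * g v)) v := by
    have h1 : HasDerivAt (fun w : ℝ => y - t * w) (-t) v := by
      simpa using ((hasDerivAt_id v).const_mul t).const_sub y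
    have h2 : HasDerivAt u (u' v * -t) v :=
      HasDerivAt.comp (h₂ := fun s : ℝ => circleDeriv φ₀ (s : UnitAddCircle)) v
        (hφ₀.circleDeriv.hasDerivAt (y - t * v)) h1
    refine (((hasDerivAt_id v).sub h2).mul (hasDerivAt_gibbs_velocity hφ₀ ε t y v)).congr_deriv ?_
    simp only [hu, hu', hg, id, Pi.sub_apply]
    ring
  have hle : -R ≤ R := by linarith
  have hftc := intervalIntegral.integral_eq_sub_of_hasDerivAt (a := -R) (b := R)
    (fun v _ => hd v) (Continuous.intervalIntegrable (by fun_prop) _ _)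
  rw [intervalIntegral.integral_of_le hle] at hftc
  have hb1 : 0 ≤ (R - u R) * g R :=
    mul_nonneg (sub_nonneg.2 (le_of_abs_le (hR _))) (hg0 R).le
  have hb2 : (-R - u (-R)) * g (-R) ≤ 0 :=
    mul_nonpos_of_nonpos_of_nonneg (by linarith [neg_le_of_abs_le (hR ((y - t * (-R) : ℝ))), hu])
      (hg0 (-R)).le
  have i1 : IntegrableOn (fun v => (1 + t * u' v) * g v) (Set.Ioc (-R) R) :=
    Continuous.integrableOn_Ioc (by fun_prop)
  have i2 : IntegrableOn (fun v => (v - u v) ^ 2 * g v) (Set.Ioc (-R) R) :=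
    Continuous.integrableOn_Ioc (by fun_prop)
  have i3 : IntegrableOn (fun v => (1 + t * C) * g v) (Set.Ioc (-R) R) :=
    Continuous.integrableOn_Ioc (by fun_prop)
  rw [integral_sub i1 (i2.const_mul _), integral_const_mul] at hftc
  have hmono : ∫ v in Set.Ioc (-R) R, (1 + t * u' v) * g v
      ≤ ∫ v in Set.Ioc (-R) R, (1 + t * C) * g v := by
    refine integral_mono i1 i3 fun v => ?_
    have := le_of_abs_le (hC ((y - t * v : ℝ)))
    have h := hg0 v
    simp only [hu']
    gcongr
  rw [integral_const_mul] at hmono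
  have h4 : t / ε * ∫ v in Set.Ioc (-R) R, (v - u v) ^ 2 * g v
      ≤ (1 + t * C) * ∫ v in Set.Ioc (-R) R, g v := by linarith
  rwa [div_mul_eq_mul_div, div_le_iff₀' hε] at h4

theorem partitionFn_pos {φ₀ : UnitAddCircle → ℝ} (hφ₀ : SmoothOnCircle φ₀)
    {ε R : ℝ} (hR : 0 < R) (t : ℝ) (x : UnitAddCircle) :
    0 < partitionFn φ₀ ε R t x := by
  induction x using QuotientAddGroup.induction_on with | H y =>
  rw [partitionFn_coe, ← intervalIntegral.integral_of_le (by linarith)]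
  exact intervalIntegral.intervalIntegral_pos_of_pos
    ((continuous_gibbs hφ₀ ε t y).intervalIntegrable _ _) (fun v => gibbs_pos φ₀ ε t y v)
    (by linarith)

theorem smooth_softHopfLax {φ₀ : UnitAddCircle → ℝ} (hφ₀ : SmoothOnCircle φ₀)
    {ε R K : ℝ} (hR : 0 < R) :
    SmoothOnTimeCircle (softHopfLax φ₀ ε R K) := by
  have hZ : ContDiff ℝ ∞ fun p : ℝ × ℝ => partitionFn φ₀ ε R p.1 (p.2 : UnitAddCircle) := by
    simp_rw [partitionFn_coe]
    refine contDiff_integral_comp (E := ℝ × ℝ) (a := fun v : ℝ => v) (R := R) measurable_id ?_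
      (contDiff_gibbs hφ₀ ε)
    filter_upwards [ae_restrict_mem measurableSet_Ioc] with v hv
    exact abs_le.2 ⟨hv.1.le, hv.2⟩
  have hlog : ContDiff ℝ ∞ fun p : ℝ × ℝ =>
      Real.log (partitionFn φ₀ ε R p.1 (p.2 : UnitAddCircle) / (2 * R)) :=
    (hZ.div_const _).log fun p => (div_pos (partitionFn_pos hφ₀ hR _ _) (by positivity)).ne'
  have harsinh : ContDiff ℝ ∞ fun p : ℝ × ℝ => Real.arsinh (p.1 / ε) :=
    (contDiff_fst.div_const ε).arsinh
  exact (contDiff_const.mul hlog).sub (contDiff_const.mul harsinh)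

theorem softHopfLax_zero {φ₀ : UnitAddCircle → ℝ} {ε R K : ℝ} (hε : ε ≠ 0) (hR : 0 < R)
    (x : UnitAddCircle) :
    softHopfLax φ₀ ε R K 0 x = φ₀ x := by
  have : partitionFn φ₀ ε R 0 x = 2 * R * Real.exp (-φ₀ x / ε) := by
    have : R + R = 2 * R := by ring
    simp [partitionFn, hR.le, this]
  rw [softHopfLax, this, mul_div_cancel_left₀ _ (by positivity), Real.log_exp]
  field_simp
  simp

/-- The Hamilton–Jacobi inequality for the soft minimum. Writing `E` for the Gibbs average,
`∂ₜ + ½(∂ₓ)²` of `-ε log Z` is `E[v²/2 - vφ₀'] + ½ E[φ₀']² ≤ ½ E[(v - φ₀')²]`, and this is at most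
`½ K ε / (t + ε)` by the concentration estimate and the bound `|v - φ₀'| ≤ 2R`. -/
theorem hamiltonJacobi_softHopfLax {φ₀ : UnitAddCircle → ℝ} (hφ₀ : SmoothOnCircle φ₀)
    {ε R C K T t : ℝ} (hε : 0 < ε) (hR0 : 0 < R)
    (hR : ∀ x, |circleDeriv φ₀ x| ≤ R) (hC : ∀ x, |circleDeriv (circleDeriv φ₀) x| ≤ C)
    (hK : 1 + T * C + (2 * R) ^ 2 ≤ K) (ht : t ∈ Set.Icc 0 T) (x : UnitAddCircle) :
    dt (softHopfLax φ₀ ε R K) t x + 1 / 2 * (dx (softHopfLax φ₀ ε R K) t x) ^ 2 ≤ 0 := by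
  induction x using QuotientAddGroup.induction_on with | H y =>
  set u : ℝ → ℝ := fun v => circleDeriv φ₀ ((y - t * v : ℝ) : UnitAddCircle) with hu
  set g : ℝ → ℝ := fun v => gibbs φ₀ ε t y v with hg
  have hgc : Continuous g := continuous_gibbs hφ₀ ε t y
  have huc : Continuous u := continuous_circleDeriv_foot hφ₀ t y
  have hg0 (v : ℝ) : 0 < g v := gibbs_pos φ₀ ε t y v
  set μ : Measure ℝ := volume.restrict (Set.Ioc (-R) R) with hμ
  have hint {f : ℝ → ℝ} (hf : Continuous f) : Integrable f μ := hf.integrableOn_Ioc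
  have hv : ∀ᵐ v ∂μ, ‖v‖ ≤ R := by
    filter_upwards [ae_restrict_mem measurableSet_Ioc] with v hv
    exact abs_le.2 ⟨hv.1.le, hv.2⟩
  set Z : ℝ := ∫ v, g v ∂μ with hZ
  have hZ0 : 0 < Z := partitionFn_pos hφ₀ hR0 t (y : UnitAddCircle)
  have hθ := smooth_softHopfLax (K := K) (ε := ε) hφ₀ hR0
  have hg1 := (contDiff_gibbs hφ₀ ε).of_le (m := 1) (by simp)
  have hZt : HasDerivAt (fun s => partitionFn φ₀ ε R s (y : UnitAddCircle))
      (∫ v, g v * (-(v ^ 2 / 2 - v * u v) / ε) ∂μ) t :=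
    hasDerivAt_integral_comp (E := ℝ × ℝ) (a := fun v : ℝ => v) (c := fun s => (s, y)) hg1
      measurable_id hv ((hasDerivAt_id t).prodMk (hasDerivAt_const t y))
      (fun v => hasDerivAt_gibbs_time hφ₀ ε t y v)
  have hZx : HasDerivAt (fun s : ℝ => partitionFn φ₀ ε R t (s : UnitAddCircle))
      (∫ v, g v * (-u v / ε) ∂μ) y :=
    hasDerivAt_integral_comp (E := ℝ × ℝ) (a := fun v : ℝ => v) (c := fun s => (t, s)) hg1
      measurable_id hv ((hasDerivAt_const y t).prodMk (hasDerivAt_id y))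
      (fun v => hasDerivAt_gibbs_space hφ₀ ε t y v)
  have hZe : partitionFn φ₀ ε R t (y : UnitAddCircle) = Z := rfl
  have hlog {f : ℝ → ℝ} {f' s : ℝ} (hf : HasDerivAt f f' s) (hs : f s = Z) :
      HasDerivAt (fun s => -ε * Real.log (f s / (2 * R))) (-ε * (f' / Z)) s := by
    have hne : f s / (2 * R) ≠ 0 := by rw [hs]; positivity
    refine (((hf.div_const (2 * R)).log hne).const_mul (-ε)).congr_deriv ?_
    rw [hs]; field_simp
  have hdt : dt (softHopfLax φ₀ ε R K) t (y : UnitAddCircle)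
      = (∫ v, (v ^ 2 / 2 - v * u v) * g v ∂μ) / Z - K / 2 * (√(1 + (t / ε) ^ 2))⁻¹ := by
    have h1 := ((hasDerivAt_id t).div_const ε).arsinh.const_mul (K / 2 * ε)
    refine (hθ.hasDerivAt_dt t _).unique (((hlog hZt hZe).sub h1).congr_deriv ?_)
    have : ∫ v, g v * (-(v ^ 2 / 2 - v * u v) / ε) ∂μ
        = -(1 / ε) * ∫ v, (v ^ 2 / 2 - v * u v) * g v ∂μ := by
      rw [← integral_const_mul]; congr 1; ext v; ring
    rw [this]
    simp only [id, smul_eq_mul]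
    field_simp
  have hdx : dx (softHopfLax φ₀ ε R K) t (y : UnitAddCircle) = (∫ v, u v * g v ∂μ) / Z := by
    refine (hθ.hasDerivAt_dx t y).unique
      (((hlog hZx hZe).sub_const (K / 2 * ε * Real.arsinh (t / ε))).congr_deriv ?_)
    have : ∫ v, g v * (-u v / ε) ∂μ = -(1 / ε) * ∫ v, u v * g v ∂μ := by
      rw [← integral_const_mul]; congr 1; ext v; ring
    rw [this]
    field_simp
  have i0 := hint hgc
  have i1 : Integrable (fun v => (v ^ 2 / 2 - v * u v) * g v) μ := hint (by fun_prop)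
  have i2 : Integrable (fun v => u v * g v) μ := hint (by fun_prop)
  have i3 : Integrable (fun v => u v ^ 2 * g v) μ := hint (by fun_prop)
  set A : ℝ := ∫ v, u v * g v ∂μ with hA
  set D : ℝ := ∫ v, (v - u v) ^ 2 * g v ∂μ with hD
  -- the Gibbs average of the square dominates the square of the average
  have hCS : A / Z * A ≤ ∫ v, u v ^ 2 * g v ∂μ := by
    have h1 : 0 ≤ ∫ v, ((u v ^ 2 * g v - 2 * (A / Z) * (u v * g v)) + (A / Z) ^ 2 * g v) ∂μ :=
      integral_nonneg fun v => by
        have := mul_nonneg (sq_nonneg (u v - A / Z)) (hg0 v).le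
        simp only [Pi.zero_apply]
        nlinarith
    rw [integral_add (by simpa using! i3.sub (i2.const_mul (2 * (A / Z)))) (i0.const_mul _),
      integral_sub i3 (i2.const_mul _), integral_const_mul, integral_const_mul] at h1
    have h2 : (A / Z) ^ 2 * Z = A / Z * A := by field_simp
    rw [← hA, ← hZ, h2] at h1
    linarith
  have hDsplit : D = 2 * (∫ v, (v ^ 2 / 2 - v * u v) * g v ∂μ) + ∫ v, u v ^ 2 * g v ∂μ := by
    rw [← integral_const_mul, ← integral_add (i1.const_mul 2) i3]
    refine integral_congr_ae (Filter.Eventually.of_forall fun v => ?_)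
    ring
  have hD1 : t * D ≤ ε * ((1 + t * C) * Z) :=
    mul_integral_sq_gibbs_le hφ₀ hε ht.1 hR0.le hR hC
  have hD2 : D ≤ (2 * R) ^ 2 * Z := by
    rw [hD, hZ, ← integral_const_mul]
    refine integral_mono_ae (hint (by fun_prop)) (hint (by fun_prop)) ?_
    filter_upwards [hv] with v hv
    have h1 : |v - u v| ≤ 2 * R := by
      have h2 := abs_sub v (u v)
      have h3 : |u v| ≤ R := hR _
      rw [Real.norm_eq_abs] at hv
      linarith
    have h2 := sq_le_sq' (neg_le_of_abs_le h1) (le_of_abs_le h1)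
    exact mul_le_mul_of_nonneg_right h2 (hg0 v).le
  have hC0 : 0 ≤ C := (abs_nonneg _).trans (hC 0)
  have hD3 : (t + ε) * D ≤ ε * (K * Z) := by
    have h1 : (1 + t * C) * Z ≤ (1 + T * C) * Z := by
      have := ht.2
      gcongr
    have h2 : (1 + T * C + (2 * R) ^ 2) * Z ≤ K * Z := by gcongr
    nlinarith
  have hsqrt : ε * √(1 + (t / ε) ^ 2) ≤ t + ε := by
    have ht0 := ht.1
    rw [show ε * √(1 + (t / ε) ^ 2) = √(ε ^ 2 * (1 + (t / ε) ^ 2)) by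
      rw [Real.sqrt_mul (sq_nonneg ε), Real.sqrt_sq hε.le]]
    refine Real.sqrt_le_iff.2 ⟨by positivity, ?_⟩
    have : ε ^ 2 * (1 + (t / ε) ^ 2) = ε ^ 2 + t ^ 2 := by field_simp
    rw [this]
    nlinarith [mul_nonneg ht0 hε.le]
  have hs0 : 0 < √(1 + (t / ε) ^ 2) := by positivity
  have hD0 : 0 ≤ D := integral_nonneg fun v => mul_nonneg (sq_nonneg _) (hg0 v).le
  have hD4 : D ≤ K * (√(1 + (t / ε) ^ 2))⁻¹ * Z := by
    have h1 : ε * (√(1 + (t / ε) ^ 2) * D) ≤ ε * (K * Z) := by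
      refine le_trans ?_ hD3
      rw [← mul_assoc]
      gcongr
    have h2 := le_of_mul_le_mul_left h1 hε
    rw [mul_right_comm, ← div_eq_mul_inv, le_div_iff₀' hs0]
    exact h2
  rw [hdt, hdx]
  have h5 : (∫ v, (v ^ 2 / 2 - v * u v) * g v ∂μ) / Z + 1 / 2 * (A / Z) ^ 2
      ≤ K / 2 * (√(1 + (t / ε) ^ 2))⁻¹ := by
    have h6 : (A / Z) ^ 2 = A / Z * A / Z := by ring
    rw [h6, ← mul_div_assoc, ← add_div, div_le_iff₀ hZ0]
    linarith
  linarith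

/-- The soft minimum stays above the minimum, up to the correction in time. -/
theorem neg_softHopfLax_le {φ₀ : UnitAddCircle → ℝ} (hφ₀ : SmoothOnCircle φ₀)
    {ε R K T h : ℝ} (hε : 0 < ε) (hR : 0 < R) (x : UnitAddCircle)
    (hmin : ∀ w, |w| ≤ R → h ≤ φ₀ (x - ((T * w : ℝ) : UnitAddCircle)) + T / 2 * w ^ 2) :
    -softHopfLax φ₀ ε R K T x ≤ -h + K / 2 * ε * Real.arsinh (T / ε) := by
  have hle : partitionFn φ₀ ε R T x ≤ 2 * R * Real.exp (-h / ε) := by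
    induction x using QuotientAddGroup.induction_on with | H y =>
    have : ∫ v in Set.Ioc (-R) R, Real.exp (-h / ε) = 2 * R * Real.exp (-h / ε) := by
      have : R + R = 2 * R := by ring
      simp [hR.le, this]
    rw [partitionFn_coe, ← this]
    refine setIntegral_mono_on (continuous_gibbs hφ₀ ε T y).integrableOn_Ioc
      continuous_const.integrableOn_Ioc measurableSet_Ioc fun v hv => ?_
    refine Real.exp_le_exp.2 (div_le_div_of_nonneg_right (neg_le_neg ?_) hε.le)
    exact hmin v (abs_le.2 ⟨hv.1.le, hv.2⟩)
  have hlog : Real.log (partitionFn φ₀ ε R T x / (2 * R)) ≤ -h / ε := by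
    rw [Real.log_le_iff_le_exp (div_pos (partitionFn_pos hφ₀ hR T x) (by positivity)),
      div_le_iff₀' (by positivity)]
    exact hle
  rw [le_div_iff₀' hε] at hlog
  rw [softHopfLax]
  linarith

theorem arsinh_le_two_mul_sqrt {y : ℝ} (hy : 0 ≤ y) : Real.arsinh y ≤ 2 * √(1 + 2 * y) := by
  have h1 : √(1 + y ^ 2) ≤ 1 + y := Real.sqrt_le_iff.2 ⟨by positivity, by nlinarith⟩
  have h2 : 0 < 1 + 2 * y := by positivity
  have h3 : Real.arsinh y ≤ Real.log (1 + 2 * y) :=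
    Real.log_le_log (by positivity) (by linarith)
  have h4 := Real.log_le_sub_one_of_pos (Real.sqrt_pos.2 h2)
  rw [Real.log_sqrt h2.le] at h4
  linarith

theorem exists_mul_arsinh_le {T : ℝ} (hT : 0 ≤ T) (K : ℝ) {δ : ℝ} (hδ : 0 < δ) :
    ∃ ε, 0 < ε ∧ K * ε * Real.arsinh (T / ε) ≤ δ := by
  have hc : Continuous fun ε : ℝ => |K| * (2 * √(ε ^ 2 + 2 * T * ε)) := by fun_prop
  have h0 : |K| * (2 * √((0 : ℝ) ^ 2 + 2 * T * 0)) < δ := by simpa using hδ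
  have hev := (hc.tendsto 0).eventually (gt_mem_nhds h0)
  obtain ⟨ε, hlt, hpos⟩ := ((hev.filter_mono nhdsWithin_le_nhds).and
    (self_mem_nhdsWithin (a := (0 : ℝ)) (s := Set.Ioi 0))).exists
  have hpos : 0 < ε := hpos
  refine ⟨ε, hpos, le_trans ?_ hlt.le⟩
  have h1 : ε * Real.arsinh (T / ε) ≤ 2 * √(ε ^ 2 + 2 * T * ε) := by
    have h2 := mul_le_mul_of_nonneg_left (arsinh_le_two_mul_sqrt (div_nonneg hT hpos.le)) hpos.le
    have h3 : ε * √(1 + 2 * (T / ε)) = √(ε ^ 2 + 2 * T * ε) := by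
      rw [show ε ^ 2 + 2 * T * ε = ε ^ 2 * (1 + 2 * (T / ε)) by field_simp,
        Real.sqrt_mul (sq_nonneg ε), Real.sqrt_sq hpos.le]
    linarith
  have h4 : 0 ≤ ε * Real.arsinh (T / ε) :=
    mul_nonneg hpos.le (Real.arsinh_nonneg_iff.2 (div_nonneg hT hpos.le))
  rw [mul_assoc]
  exact (mul_le_mul_of_nonneg_right (le_abs_self K) h4).trans
    (mul_le_mul_of_nonneg_left h1 (abs_nonneg K))

/-- Smooth subsolutions come arbitrarily close, at time `T`, to any function below the Hopf–Lax
quantities. -/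
theorem exists_subsolution {φ₀ : UnitAddCircle → ℝ} (hφ₀ : SmoothOnCircle φ₀) {T R δ : ℝ}
    (hT : 0 < T) (hR0 : 0 < R) (hR : ∀ x, |circleDeriv φ₀ x| ≤ R) (hδ : 0 < δ)
    {h : UnitAddCircle → ℝ} (hmin : ∀ x w, |w| ≤ R →
      h x ≤ φ₀ (x - ((T * w : ℝ) : UnitAddCircle)) + T / 2 * w ^ 2) :
    ∃ θ, Subsolution T φ₀ θ ∧ ∀ x, -θ T x ≤ -h x + δ := by
  obtain ⟨C, -, hC⟩ := exists_abs_le_of_continuous hφ₀.circleDeriv.circleDeriv.continuous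
  obtain ⟨ε, hε, hle⟩ := exists_mul_arsinh_le hT.le ((1 + T * C + (2 * R) ^ 2) / 2) hδ
  refine ⟨softHopfLax φ₀ ε R (1 + T * C + (2 * R) ^ 2), ⟨smooth_softHopfLax hφ₀ hR0,
    softHopfLax_zero hε.ne' hR0, fun t ht x =>
      hamiltonJacobi_softHopfLax hφ₀ hε hR0 hR hC le_rfl ht x⟩, fun x => ?_⟩
  exact (neg_softHopfLax_le hφ₀ hε hR0 x (hmin x)).trans (by gcongr)

/-! ### Approximation by smooth potentials -/

/-- Smooth probability densities on the circle concentrating at `0`: normalized powers of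
`(1 + cos (2πs)) / 2`. -/
theorem exists_peak_functions :
    ∃ p : ℕ → UnitAddCircle → ℝ, (∀ n, SmoothOnCircle (p n)) ∧ (∀ n x, 0 ≤ p n x) ∧
      (∀ n, ∫ x, p n x = 1) ∧ ∀ g : UnitAddCircle → ℝ, Continuous g →
        Filter.Tendsto (fun n => ∫ x, p n x * g x) Filter.atTop (nhds (g 0)) := by
  have hper : Function.Periodic (fun s : ℝ => (1 + Real.cos (2 * Real.pi * s)) / 2) 1 := fun s => by
    simp only [mul_add, mul_one, Real.cos_add_two_pi]
  set c : UnitAddCircle → ℝ := hper.lift with hc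
  have hcoe (s : ℝ) : c (s : UnitAddCircle) = (1 + Real.cos (2 * Real.pi * s)) / 2 :=
    hper.lift_coe s
  have hsm (n : ℕ) : SmoothOnCircle fun x => c x ^ n := by
    unfold SmoothOnCircle
    simp_rw [hcoe]
    fun_prop
  have hcs : SmoothOnCircle c := by simpa using hsm 1
  have hcc := hcs.continuous
  have h0 (x : UnitAddCircle) : 0 ≤ c x := by
    induction x using QuotientAddGroup.induction_on with | H y =>
    have h1 := hcoe y
    have h2 := Real.neg_one_le_cos (2 * Real.pi * y)
    change 0 ≤ c (y : UnitAddCircle)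
    linarith
  have hc0 : c 0 = 1 := by
    have := hcoe 0
    simpa using this
  have hlt (x : UnitAddCircle) (hx : x ≠ 0) : c x < c 0 := by
    induction x using QuotientAddGroup.induction_on with | H y =>
    have h2 : Real.cos (2 * Real.pi * y) ≠ 1 := fun h => by
      obtain ⟨k, hk⟩ := (Real.cos_eq_one_iff _).1 h
      refine hx ((AddCircle.coe_eq_zero_iff 1).2 ⟨k, ?_⟩)
      have h3 : (2 * Real.pi) * (k : ℝ) = (2 * Real.pi) * y := by linarith
      simpa using mul_left_cancel₀ (by positivity) h3
    have h3 := lt_of_le_of_ne (Real.cos_le_one _) h2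
    rw [hc0, hcoe]
    linarith
  have hpos (n : ℕ) : 0 < ∫ x, c x ^ n :=
    (hcc.pow n).integral_pos_of_hasCompactSupport_nonneg_nonzero
      (HasCompactSupport.of_compactSpace _) (fun x => pow_nonneg (h0 x) n) (x := 0) (by simp [hc0])
  refine ⟨fun n x => (∫ x, c x ^ n)⁻¹ * c x ^ n, fun n => contDiff_const.mul (hsm n),
    fun n x => mul_nonneg (inv_nonneg.2 (hpos n).le) (pow_nonneg (h0 x) n), fun n => ?_,
    fun g hg => ?_⟩
  · rw [integral_const_mul, inv_mul_cancel₀ (hpos n).ne']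
  · have := tendsto_setIntegral_pow_smul_of_unique_maximum_of_isCompact_of_continuousOn
      (μ := (volume : Measure UnitAddCircle)) (x₀ := (0 : UnitAddCircle)) isCompact_univ
      hcc.continuousOn (fun y _ hy => hlt y hy) (fun x _ => h0 x) (by rw [hc0]; exact one_pos)
      (by simp) hg.continuousOn
    simpa only [Measure.restrict_univ, smul_eq_mul, ← integral_const_mul, mul_assoc] using this

theorem volume_real_univ : (volume : Measure UnitAddCircle).real Set.univ = 1 := by
  simp [measureReal_def]

/-- A smooth function of mean zero on the circle has a smooth primitive. -/
theorem exists_primitive {f : UnitAddCircle → ℝ} (hf : SmoothOnCircle f) (h0 : ∫ x, f x = 0) :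
    ∃ F : UnitAddCircle → ℝ, SmoothOnCircle F ∧ ∀ x, circleDeriv F x = f x := by
  have hfc : Continuous fun s : ℝ => f (s : UnitAddCircle) := ContDiff.continuous hf
  have hper1 : Function.Periodic (fun s : ℝ => f (s : UnitAddCircle)) 1 := fun s => by simp
  have hper : Function.Periodic (fun s : ℝ => ∫ r in (0 : ℝ)..s, f (r : UnitAddCircle)) 1 := by
    intro s
    simp only
    rw [← intervalIntegral.integral_add_adjacent_intervals (b := s) (hfc.intervalIntegrable _ _)
      (hfc.intervalIntegrable _ _), UnitAddCircle.intervalIntegral_preimage s f, h0, add_zero]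
  have hd (s : ℝ) : HasDerivAt (fun s : ℝ => ∫ r in (0 : ℝ)..s, f (r : UnitAddCircle))
      (f (s : UnitAddCircle)) s :=
    intervalIntegral.integral_hasDerivAt_right (hfc.intervalIntegrable _ _)
      (hfc.stronglyMeasurableAtFilter _ _) hfc.continuousAt
  have hderiv : deriv (fun s : ℝ => ∫ r in (0 : ℝ)..s, f (r : UnitAddCircle))
      = fun s : ℝ => f (s : UnitAddCircle) := funext fun s => (hd s).deriv
  refine ⟨hper.lift, ?_, fun x => ?_⟩
  · change ContDiff ℝ ∞ fun s : ℝ => ∫ r in (0 : ℝ)..s, f (r : UnitAddCircle)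
    rw [contDiff_infty_iff_deriv, hderiv]
    exact ⟨fun s => (hd s).differentiableAt, hf⟩
  · induction x using QuotientAddGroup.induction_on with | H y =>
    exact (circleDeriv_coe _ y).trans (hd y).deriv

/-- The density and momentum of the flow, smoothed in space with a probability density `p`, are
`1 - ∂ₓW` and `∂ₜW` for an admissible potential `W`. No smoothing in time is needed, as the
trajectories are straight. -/
theorem exists_potential {T R : ℝ} {V : UnitAddCircle → ℝ} (hV : Measurable V)
    (hR : ∀ x, |V x| ≤ R) {p : UnitAddCircle → ℝ} (hp : SmoothOnCircle p) (hp0 : ∀ x, 0 ≤ p x)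
    (hp1 : ∫ x, p x = 1) :
    ∃ W, AdmissibleW T W ∧ (∀ t x, dt W t x = ∫ y, V y * p (x - position T V t y)) ∧
      ∀ t x, kin (1 - dx W t x) (dt W t x)
        ≤ ENNReal.ofReal ((∫ y, V y ^ 2 * p (x - position T V t y)) / 2) := by
  obtain ⟨C, hC0, hC⟩ := exists_abs_le_of_continuous hp.continuous
  have hpi : Integrable p := hp.continuous.integrable_of_hasCompactSupport
    (HasCompactSupport.of_compactSpace _)
  obtain ⟨Ψ, hΨ, hΨd⟩ := exists_primitive (f := fun x => 1 - p x) (ContDiff.sub contDiff_const hp)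
    (by rw [integral_sub (integrable_const _) hpi, hp1]; simp [volume_real_univ])
  set r : UnitAddCircle → ℝ := fun y => (AddCircle.measurableEquivIoc 1 0 y : ℝ) with hr
  have hrc (y : UnitAddCircle) : ((r y : ℝ) : UnitAddCircle) = y :=
    AddCircle.coe_equivIoc (p := (1 : ℝ)) (a := 0)
  have hrm : Measurable r := measurable_subtype_coe.comp (MeasurableEquiv.measurable _)
  have hr1 (y : UnitAddCircle) : |r y| ≤ 1 := by
    have := (AddCircle.measurableEquivIoc 1 0 y : Set.Ioc (0 : ℝ) (0 + 1)).2
    exact abs_le.2 ⟨by linarith [this.1], by linarith [this.2]⟩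
  set f : (ℝ × ℝ) × (ℝ × ℝ) → ℝ := fun z =>
    Ψ ((z.1.2 - z.2.1 + (T - z.1.1) * z.2.2 : ℝ) : UnitAddCircle) - (T - z.1.1) * z.2.2 with hf
  have hfs : ContDiff ℝ ∞ f := by
    have h : ContDiff ℝ ∞ fun z : (ℝ × ℝ) × (ℝ × ℝ) =>
        Ψ ((z.1.2 - z.2.1 + (T - z.1.1) * z.2.2 : ℝ) : UnitAddCircle) :=
      ContDiff.comp (g := fun s : ℝ => Ψ (s : UnitAddCircle)) hΨ (by fun_prop)
    exact h.sub (by fun_prop)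
  set a : UnitAddCircle → ℝ × ℝ := fun y => (r y, V y) with ha
  have ham : Measurable a := hrm.prodMk hV
  have haR : ∀ᵐ y ∂(volume : Measure UnitAddCircle), ‖a y‖ ≤ max 1 R :=
    Filter.Eventually.of_forall fun y => max_le_max (hr1 y) (hR y)
  have hpos (t s : ℝ) (y : UnitAddCircle) :
      ((s - r y + (T - t) * V y : ℝ) : UnitAddCircle) = (s : UnitAddCircle) - position T V t y := by
    rw [AddCircle.coe_add, AddCircle.coe_sub, hrc, position]
    abel
  -- the potential, normalized to vanish at time `T`
  set W : ℝ → UnitAddCircle → ℝ := fun t x =>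
    (∫ y, (Ψ (x - position T V t y) - (T - t) * V y)) - ∫ y, Ψ y with hW
  have hWcoe (t s : ℝ) : W t (s : UnitAddCircle) = (∫ y, f ((t, s), a y)) - ∫ y, Ψ y := by
    simp only [hW, hf, ha, hpos]
  have hWs : SmoothOnTimeCircle W := by
    unfold SmoothOnTimeCircle
    simp_rw [hWcoe]
    exact (contDiff_integral_comp (E := ℝ × ℝ) ham haR hfs).sub contDiff_const
  have hf1 := hfs.of_le (m := 1) (by simp)
  have hdt (t : ℝ) (x : UnitAddCircle) : dt W t x = ∫ y, V y * p (x - position T V t y) := by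
    induction x using QuotientAddGroup.induction_on with | H s =>
    refine (hWs.hasDerivAt_dt t _).unique ?_
    simp_rw [hWcoe]
    have h1 : HasDerivAt (fun τ => ∫ y, f ((τ, s), a y))
        (∫ y, (a y).2 * p ((s - (a y).1 + (T - t) * (a y).2 : ℝ) : UnitAddCircle)) t := by
      refine hasDerivAt_integral_comp (E := ℝ × ℝ) (c := fun τ => (τ, s))
        (D := fun h => h.2 * p ((s - h.1 + (T - t) * h.2 : ℝ) : UnitAddCircle)) hf1
        ham haR ((hasDerivAt_id t).prodMk (hasDerivAt_const t s)) fun h => ?_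
      have h2 : HasDerivAt (fun τ : ℝ => (T - τ) * h.2) (-h.2) t := by
        simpa using ((hasDerivAt_id t).const_sub T).mul_const h.2
      have h3 := HasDerivAt.comp (h₂ := fun s : ℝ => Ψ (s : UnitAddCircle)) t
        (hΨ.hasDerivAt (s - h.1 + (T - t) * h.2)) (h2.const_add (s - h.1))
      refine (h3.sub h2).congr_deriv ?_
      rw [hΨd]; ring
    refine (h1.sub_const (∫ y, Ψ y)).congr_deriv ?_
    simp only [ha, hpos]
  have hdx (t : ℝ) (x : UnitAddCircle) : dx W t x = 1 - ∫ y, p (x - position T V t y) := by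
    induction x using QuotientAddGroup.induction_on with | H s =>
    refine (hWs.hasDerivAt_dx t s).unique ?_
    simp_rw [hWcoe]
    have h1 : HasDerivAt (fun σ => ∫ y, f ((t, σ), a y))
        (∫ y, (1 - p ((s - (a y).1 + (T - t) * (a y).2 : ℝ) : UnitAddCircle))) s := by
      refine hasDerivAt_integral_comp (E := ℝ × ℝ) (c := fun σ => (t, σ))
        (D := fun h => 1 - p ((s - h.1 + (T - t) * h.2 : ℝ) : UnitAddCircle)) hf1
        ham haR ((hasDerivAt_const s t).prodMk (hasDerivAt_id s)) fun h => ?_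
      have h3 := HasDerivAt.comp (h₂ := fun s : ℝ => Ψ (s : UnitAddCircle)) s
        (hΨ.hasDerivAt (s - h.1 + (T - t) * h.2))
        (((hasDerivAt_id s).sub_const h.1).add_const ((T - t) * h.2))
      refine (h3.sub_const ((T - t) * h.2)).congr_deriv ?_
      rw [hΨd]; ring
    refine (h1.sub_const (∫ y, Ψ y)).congr_deriv ?_
    simp only [ha, hpos]
    rw [integral_sub (integrable_const _)]
    · simp [volume_real_univ]
    · refine Integrable.of_bound (C := C) ?_ (Filter.Eventually.of_forall fun y => hC _)
      exact (hp.continuous.measurable.comp (measurable_const.sub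
        ((measurable_position hV).comp measurable_prodMk_left))).aestronglyMeasurable
  -- the average over `y` of `(V y - σ)²` is nonnegative for every `σ`
  have key (t : ℝ) (x : UnitAddCircle) := by
    have hm : Measurable fun y => p (x - position T V t y) :=
      hp.continuous.measurable.comp (measurable_const.sub
        ((measurable_position hV).comp measurable_prodMk_left))
    have i0 : Integrable fun y => p (x - position T V t y) :=
      Integrable.of_bound (C := C) hm.aestronglyMeasurable
        (Filter.Eventually.of_forall fun y => hC _)
    have i1 : Integrable fun y => V y * p (x - position T V t y) :=
      i0.bdd_mul (c := R) hV.aestronglyMeasurable (Filter.Eventually.of_forall hR)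
    have i2 : Integrable fun y => V y ^ 2 * p (x - position T V t y) := by
      simp_rw [pow_two, mul_assoc]
      exact i1.bdd_mul (c := R) hV.aestronglyMeasurable (Filter.Eventually.of_forall hR)
    refine kin_le_of_forall (D := ∫ y, p (x - position T V t y))
      (N := ∫ y, V y * p (x - position T V t y)) (E := ∫ y, V y ^ 2 * p (x - position T V t y))
      (integral_nonneg fun y => hp0 _) fun σ => ?_
    rw [← integral_const_mul, ← integral_const_mul, ← integral_sub i2 (i1.const_mul _),
      ← integral_add (by simpa using! i2.sub (i1.const_mul (2 * σ))) (i0.const_mul _)]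
    refine integral_nonneg fun y => ?_
    have := mul_nonneg (sq_nonneg (V y - σ)) (hp0 (x - position T V t y))
    simp only [Pi.zero_apply]
    nlinarith
  refine ⟨W, ⟨hWs, fun x => ?_, fun t _ x => ?_, fun t _ x h => ?_⟩, hdt, fun t x => ?_⟩
  · simp only [hW, position, sub_self, zero_mul, AddCircle.coe_zero, sub_zero]
    rw [integral_sub_left_eq_self Ψ volume x, sub_self]
  · rw [hdx]
    have : 0 ≤ ∫ y, p (x - position T V t y) := integral_nonneg fun y => hp0 _
    linarith
  · rw [hdx] at h
    rw [hdt]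
    exact (key t x).2 (by linarith)
  · rw [hdx, hdt, sub_sub_cancel]
    exact (key t x).1

theorem integrable_smoothed {T R C B : ℝ} {V : UnitAddCircle → ℝ} (hV : Measurable V)
    {A : UnitAddCircle → ℝ} (hA : Measurable A) (hAR : ∀ x, |A x| ≤ R)
    {p b : UnitAddCircle → ℝ} (hp : Continuous p) (hC : ∀ x, |p x| ≤ C)
    (hb : Continuous b) (hB : ∀ x, |b x| ≤ B) :
    Integrable (fun z : Strip T => (∫ y, A y * p (z.2 - position T V z.1 y)) * b z.2)
      (stripVolume T) := by
  have hR0 : 0 ≤ R := (abs_nonneg _).trans (hAR 0)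
  have hbd (t : ℝ) (x : UnitAddCircle) : ‖∫ y, A y * p (x - position T V t y)‖ ≤ R * C := by
    have := norm_integral_le_of_norm_le_const (μ := (volume : Measure UnitAddCircle))
      (f := fun y => A y * p (x - position T V t y)) (C := R * C)
      (Filter.Eventually.of_forall fun y => by
        rw [norm_mul]; exact mul_le_mul (hAR _) (hC _) (norm_nonneg _) hR0)
    simpa [volume_real_univ] using this
  have hm : StronglyMeasurable fun q : Strip T × UnitAddCircle =>
      A q.2 * p (q.1.2 - position T V q.1.1 q.2) := by
    refine Measurable.stronglyMeasurable ((hA.comp measurable_snd).mul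
      (hp.measurable.comp ((measurable_snd.comp measurable_fst).sub ?_)))
    exact (measurable_position hV).comp (f := fun q : Strip T × UnitAddCircle => ((q.1.1 : ℝ), q.2))
      ((measurable_subtype_coe.comp (measurable_fst.comp measurable_fst)).prodMk measurable_snd)
  have hI : Integrable (fun z : Strip T => ∫ y, A y * p (z.2 - position T V z.1 y))
      (stripVolume T) :=
    Integrable.of_bound hm.integral_prod_right'.aestronglyMeasurable (R * C)
      (Filter.Eventually.of_forall fun z => hbd z.1 z.2)
  exact hI.mul_bdd (c := B) (hb.comp continuous_snd).aestronglyMeasurable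
    (Filter.Eventually.of_forall fun z => hB z.2)

/-- Integrating a smoothed quantity against `b` is the same as integrating the original quantity
against the smoothing of `b`. -/
theorem integral_smoothed {T R : ℝ} (hT : 0 ≤ T) {V : UnitAddCircle → ℝ} (hV : Measurable V)
    {A : UnitAddCircle → ℝ} (hA : Measurable A) (hAR : ∀ x, |A x| ≤ R)
    {p b : UnitAddCircle → ℝ} (hp : Continuous p) (hb : Continuous b) :
    Integrable (fun z : Strip T => A z.2 * ∫ w, p w * b (w + position T V z.1 z.2))
        (stripVolume T) ∧
      ∫ z : Strip T, (∫ y, A y * p (z.2 - position T V z.1 y)) * b z.2 ∂(stripVolume T)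
        = ∫ z : Strip T, A z.2 * (∫ w, p w * b (w + position T V z.1 z.2)) ∂(stripVolume T) := by
  obtain ⟨C, hC0, hC⟩ := exists_abs_le_of_continuous hp
  obtain ⟨B, hB0, hB⟩ := exists_abs_le_of_continuous hb
  have hR0 : 0 ≤ R := (abs_nonneg _).trans (hAR 0)
  have hsm : Continuous fun x : UnitAddCircle => ∫ w, p w * b (w + x) := by
    refine continuous_of_dominated (bound := fun _ => C * B) (fun x => ?_) (fun x => ?_)
      (integrable_const _) ?_
    · exact (hp.mul (hb.comp (continuous_id.add continuous_const))).aestronglyMeasurable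
    · refine Filter.Eventually.of_forall fun w => ?_
      rw [norm_mul]
      exact mul_le_mul (hC _) (hB _) (norm_nonneg _) hC0
    · exact Filter.Eventually.of_forall fun w =>
        continuous_const.mul (hb.comp (continuous_const.add continuous_id))
  obtain ⟨D, hD0, hD⟩ := exists_abs_le_of_continuous hsm
  have hposm : Measurable fun z : Strip T => position T V z.1 z.2 :=
    (measurable_position hV).comp (f := fun z : Strip T => ((z.1 : ℝ), z.2))
      ((measurable_subtype_coe.comp measurable_fst).prodMk measurable_snd)
  have hI : Integrable (fun z : Strip T => A z.2 * ∫ w, p w * b (w + position T V z.1 z.2))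
      (stripVolume T) := by
    refine Integrable.of_bound (C := R * D) ((hA.comp measurable_snd).mul
      (hsm.measurable.comp hposm)).aestronglyMeasurable (Filter.Eventually.of_forall fun z => ?_)
    rw [norm_mul]
    exact mul_le_mul (hAR _) (hD _) (norm_nonneg _) hR0
  refine ⟨hI, ?_⟩
  rw [integral_strip' hT (f := fun t x => (∫ y, A y * p (x - position T V t y)) * b x)
    (integrable_smoothed hV hA hAR hp hC hb hB), integral_strip' hT
      (f := fun t x => A x * ∫ w, p w * b (w + position T V t x)) hI]
  congr 1; ext t
  have hpt : Measurable fun y => position T V t y :=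
    (measurable_position hV).comp measurable_prodMk_left
  have hint : Integrable (Function.uncurry fun (x y : UnitAddCircle) =>
      A y * p (x - position T V t y) * b x)
      ((volume : Measure UnitAddCircle).prod (volume : Measure UnitAddCircle)) := by
    refine Integrable.of_bound (C := R * C * B) ?_ (Filter.Eventually.of_forall fun q => ?_)
    · exact (((hA.comp measurable_snd).mul (hp.measurable.comp
        (measurable_fst.sub (hpt.comp measurable_snd)))).mul
          (hb.measurable.comp measurable_fst)).aestronglyMeasurable
    · simp only [Function.uncurry, norm_mul]
      exact mul_le_mul (mul_le_mul (hAR _) (hC _) (norm_nonneg _) hR0) (hB _) (norm_nonneg _)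
        (mul_nonneg hR0 hC0)
  simp_rw [← integral_mul_const]
  rw [integral_integral_swap hint]
  congr 1; ext y
  rw [← integral_sub_right_eq_self
    (fun w => p w * b (w + position T V t y)) (position T V t y), ← integral_const_mul]
  congr 1; ext x
  rw [sub_add_cancel, mul_assoc]

/-- The action of any bounded measurable velocity field is a lower bound for the optimal value,
by passing to the limit in the smoothed potentials. -/
theorem action_le_optimalValue {T R : ℝ} (hT : 0 < T) {u₀ V : UnitAddCircle → ℝ}
    (hu : Continuous u₀) (hV : Measurable V) (hR : ∀ x, |V x| ≤ R) :
    ((∫ z : Strip T, (V z.2 * u₀ (flow T V z).2 - 1 / 2 * V z.2 ^ 2) ∂(stripVolume T) : ℝ) : EReal)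
      ≤ optimalValue T u₀ := by
  obtain ⟨p, hps, hp0, hp1, hpt⟩ := exists_peak_functions
  obtain ⟨B, hB0, hB⟩ := exists_abs_le_of_continuous hu
  have hR0 : 0 ≤ R := (abs_nonneg _).trans (hR 0)
  have hVm : Measurable fun z : Strip T => V z.2 := hV.comp measurable_snd
  have hVs : Integrable (fun z : Strip T => V z.2) (stripVolume T) :=
    Integrable.of_bound hVm.aestronglyMeasurable R (Filter.Eventually.of_forall fun z => hR z.2)
  have hV2 : Integrable (fun z : Strip T => 1 / 2 * V z.2 ^ 2) (stripVolume T) := by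
    simp_rw [pow_two]
    exact (hVs.bdd_mul (c := R) hVm.aestronglyMeasurable
      (Filter.Eventually.of_forall fun z => hR z.2)).const_mul _
  have huV : Integrable (fun z : Strip T => V z.2 * u₀ (flow T V z).2) (stripVolume T) :=
    hVs.mul_bdd (c := B) ((hu.measurable.comp measurable_snd).comp
      (measurable_flow hV)).aestronglyMeasurable (Filter.Eventually.of_forall fun z => hB _)
  have hpi (n : ℕ) : Integrable (p n) := (hps n).continuous.integrable_of_hasCompactSupport
    (HasCompactSupport.of_compactSpace _)
  have hlim : Filter.Tendsto (fun n => ∫ z : Strip T, V z.2 *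
      (∫ w, p n w * u₀ (w + position T V z.1 z.2)) ∂(stripVolume T)) Filter.atTop
      (nhds (∫ z : Strip T, V z.2 * u₀ (flow T V z).2 ∂(stripVolume T))) := by
    refine tendsto_integral_of_dominated_convergence (fun _ => R * B)
      (fun n => (integral_smoothed hT.le hV hV hR (hps n).continuous hu).1.aestronglyMeasurable)
      (integrable_const _) (fun n => Filter.Eventually.of_forall fun z => ?_)
      (Filter.Eventually.of_forall fun z => ?_)
    · rw [norm_mul]
      refine mul_le_mul (hR _) ?_ (norm_nonneg _) hR0
      refine (norm_integral_le_of_norm_le ((hpi n).mul_const B)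
        (Filter.Eventually.of_forall fun w => ?_)).trans ?_
      · rw [norm_mul, Real.norm_of_nonneg (hp0 n w)]
        exact mul_le_mul_of_nonneg_left (hB _) (hp0 n w)
      · rw [integral_mul_const, hp1, one_mul]
    · have h := hpt (fun w => u₀ (w + position T V z.1 z.2))
        (hu.comp (continuous_id.add continuous_const))
      rw [zero_add] at h
      exact h.const_mul _
  rw [integral_sub huV hV2]
  refine le_of_tendsto' ((continuous_coe_real_ereal.tendsto _).comp (hlim.sub_const _)) fun n => ?_
  obtain ⟨W, hW, hWt, hWk⟩ := exists_potential (T := T) hV hR (hps n) (hp0 n) (hp1 n)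
  refine le_trans ?_ (le_iSup₂_of_le W hW le_rfl)
  obtain ⟨C, hC0, hC⟩ := exists_abs_le_of_continuous (hps n).continuous
  have hA : Measurable fun y => 1 / 2 * V y ^ 2 := by fun_prop
  have hAR (y : UnitAddCircle) : |1 / 2 * V y ^ 2| ≤ 1 / 2 * R ^ 2 := by
    rw [abs_of_nonneg (by positivity)]
    have := sq_le_sq' (neg_le_of_abs_le (hR y)) (le_of_abs_le (hR y))
    linarith
  have hone : Continuous fun _ : UnitAddCircle => (1 : ℝ) := continuous_const
  have hkin : ∫⁻ z : Strip T, kin (1 - dx W z.1 z.2) (dt W z.1 z.2) ∂(stripVolume T)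
      ≤ ENNReal.ofReal (∫ z : Strip T, 1 / 2 * V z.2 ^ 2 ∂(stripVolume T)) := by
    have h1 := (integral_smoothed hT.le hV hA hAR (hps n).continuous hone).2
    simp only [mul_one, hp1] at h1
    have h2 := integrable_smoothed (T := T) hV hA hAR (hps n).continuous hC hone
      (B := 1) (fun _ => by simp)
    simp only [mul_one] at h2
    rw [← h1, ofReal_integral_eq_lintegral_ofReal h2 (Filter.Eventually.of_forall fun z =>
      integral_nonneg fun y => mul_nonneg (by positivity) (hp0 n _))]
    refine lintegral_mono fun z => (hWk z.1 z.2).trans (le_of_eq ?_)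
    congr 1
    rw [← integral_div]
    congr 1; ext y; ring
  have hlin : ∫ z : Strip T, dt W z.1 z.2 * u₀ z.2 ∂(stripVolume T)
      = ∫ z : Strip T, V z.2 * (∫ w, p n w * u₀ (w + position T V z.1 z.2)) ∂(stripVolume T) := by
    simp_rw [hWt]
    exact (integral_smoothed hT.le hV hV hR (hps n).continuous hu).2
  rw [objectiveW, hlin, Function.comp_apply, EReal.coe_sub]
  refine EReal.sub_le_sub le_rfl ?_
  have h3 := EReal.coe_ennreal_le_coe_ennreal_iff.2 hkin
  rwa [EReal.coe_ennreal_ofReal, max_eq_left (integral_nonneg fun z => by positivity)] at h3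

end Burgers

theorem mainTheorem4 (T : ℝ) (hT : 0 < T) (u₀ φ₀ : UnitAddCircle → ℝ)
    (hφ₀ : Burgers.SmoothOnCircle φ₀) (hmean : ∫ x, φ₀ x = 0)
    (hu₀ : ∀ x, u₀ x = Burgers.circleDeriv φ₀ x) :
    Burgers.optimalValue T u₀ = Burgers.optimalValueMeasure T u₀ ∧
    (∃ (ρ : Measure (Burgers.Strip T)) (q : SignedMeasure (Burgers.Strip T))
        (v : Burgers.Strip T → ℝ),
      Burgers.AdmissiblePair T ρ q ∧
      Burgers.objectivePair u₀ ρ q = Burgers.optimalValue T u₀ ∧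
      MemLp v 2 ρ ∧
      q = ρ.withDensityᵥ v ∧
      Burgers.optimalValue T u₀ =
        ((∫ z, (-(1 / 2) * v z ^ 2 + v z * u₀ z.2) ∂ρ : ℝ) : EReal)) ∧
    Burgers.optimalValue T u₀ =
      ⨅ (θ : ℝ → UnitAddCircle → ℝ) (_ : Burgers.Subsolution T φ₀ θ),
        ((∫ x, -θ T x : ℝ) : EReal) := by
  obtain ⟨C, hC0, hC⟩ := Burgers.exists_abs_le_of_continuous hφ₀.circleDeriv.continuous
  have hR0 : 0 < C + 1 := by linarith
  have hCR (x : UnitAddCircle) : |Burgers.circleDeriv φ₀ x| ≤ C + 1 := (hC x).trans (by linarith)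
  obtain ⟨V, hV, hVR, hmin⟩ := Burgers.exists_measurable_minimizer hφ₀.continuous hT hR0.le
  have hu : Continuous u₀ := by rw [funext hu₀]; exact hφ₀.circleDeriv.continuous
  obtain ⟨ρ, v, hfin, hvm, hvR, hadm, hval⟩ :=
    Burgers.exists_admissiblePair hT hR0.le hφ₀ hu₀ hV hVR
  have haction := Burgers.integral_action_flow hT hφ₀ hmean hu₀ hV hVR
  have hlow := Burgers.action_le_optimalValue hT hu hV hVR
  set J : ℝ := ∫ z : Burgers.Strip T, (V z.2 * u₀ (Burgers.flow T V z).2 - 1 / 2 * V z.2 ^ 2)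
    ∂(Burgers.stripVolume T) with hJ
  set I : EReal := ⨅ (θ : ℝ → UnitAddCircle → ℝ) (_ : Burgers.Subsolution T φ₀ θ),
    ((∫ x, -θ T x : ℝ) : EReal) with hI
  have hfoot : Integrable fun x =>
      -(φ₀ (x - ((T * V x : ℝ) : UnitAddCircle)) + T / 2 * V x ^ 2) := by
    obtain ⟨B, -, hB⟩ := Burgers.exists_abs_le_of_continuous hφ₀.continuous
    refine Integrable.of_bound (C := B + T / 2 * (C + 1) ^ 2) ?_
      (Filter.Eventually.of_forall fun x => ?_)
    · exact ((hφ₀.continuous.measurable.comp (measurable_id.sub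
        ((AddCircle.continuous_mk' 1).measurable.comp (measurable_const.mul hV)))).add
          (measurable_const.mul (hV.pow_const 2))).neg.aestronglyMeasurable
    · rw [norm_neg]
      refine (norm_add_le _ _).trans (add_le_add (hB _) ?_)
      rw [Real.norm_of_nonneg (by positivity)]
      have := sq_le_sq' (neg_le_of_abs_le (hVR x)) (le_of_abs_le (hVR x))
      gcongr
  have hIJ : I ≤ (J : EReal) := by
    refine EReal.le_of_forall_lt_iff_le.1 fun c hc => ?_
    have hc : 0 < c - J := sub_pos.2 (EReal.coe_lt_coe_iff.1 hc)
    obtain ⟨θ, hθ, hθT⟩ := Burgers.exists_subsolution hφ₀ hT hR0 hCR hc hmin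
    refine (iInf₂_le θ hθ).trans (EReal.coe_le_coe_iff.2 ?_)
    have hθi : Integrable fun x => -θ T x :=
      (hθ.smooth.continuous.comp (continuous_const.prodMk
        continuous_id)).neg.integrable_of_hasCompactSupport (HasCompactSupport.of_compactSpace _)
    refine (integral_mono hθi (hfoot.add (integrable_const (c - J))) hθT).trans (le_of_eq ?_)
    simp only [Pi.add_apply]
    rw [integral_add hfoot (integrable_const _), ← haction]
    simp [Burgers.volume_real_univ]
  have hW : Burgers.optimalValue T u₀ ≤ I := iSup₂_le fun W hW => le_iInf₂ fun θ hθ =>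
    Burgers.objectiveW_le hφ₀ hmean hu₀ hT hθ hW
  have hM : Burgers.optimalValueMeasure T u₀ ≤ I := iSup₂_le fun ρ q => iSup_le fun h =>
    le_iInf₂ fun θ hθ => Burgers.objectivePair_le hφ₀ hmean hu₀ hθ h
  have hpair : (J : EReal) ≤ Burgers.objectivePair u₀ ρ (ρ.withDensityᵥ v) := by
    rw [Burgers.objectivePair_withDensityᵥ hu hvm hvR]
    exact EReal.coe_le_coe_iff.2 hval
  have hpairM : Burgers.objectivePair u₀ ρ (ρ.withDensityᵥ v) ≤ Burgers.optimalValueMeasure T u₀ :=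
    le_iSup₂_of_le ρ (ρ.withDensityᵥ v) (le_iSup_of_le hadm le_rfl)
  have hopt : Burgers.optimalValue T u₀ = J := le_antisymm (hW.trans hIJ) hlow
  have hobj : Burgers.objectivePair u₀ ρ (ρ.withDensityᵥ v) = J :=
    le_antisymm (hpairM.trans (hM.trans hIJ)) hpair
  refine ⟨?_, ⟨ρ, ρ.withDensityᵥ v, v, hadm, by rw [hobj, hopt], ?_, rfl, ?_⟩, ?_⟩
  · rw [hopt]
    exact le_antisymm (hpair.trans hpairM) (hM.trans hIJ)
  · exact MemLp.of_bound hvm.aestronglyMeasurable (C + 1) (Filter.Eventually.of_forall hvR)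
  · rw [hopt, ← hobj, Burgers.objectivePair_withDensityᵥ hu hvm hvR]
  · exact le_antisymm hW (by rw [hopt]; exact hIJ)
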